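/- Let $G$ and $G_1,\dots,G_J$ be (Hausdorff, finite-dimensional, real) Lie groups with Lie algebras $\mathfrak g$ and $\mathfrak g_1,\dots,\mathfrak g_J$, let $p_1,\dots,p_J\in[1,\infty]$, and let $\sigma_j\colon G\to G_j$ be homomorphisms such that $\boldsymbol\sigma=(\sigma_1,\dots,\sigma_J)$ is an isomorphism of topological groups from $G$ onto a closed subgroup of $G_1\times\dots\times G_J$ (that is, after identifying $G$ with this closed subgroup, each $\sigma_j$ is the restriction to $G$ of the canonical projection onto $G_j$; such a datum $(G,\boldsymbol\sigma,\boldsymbol p)$ is called canonical). Let $\mathrm d\sigma_j\colon\mathfrak g\to\mathfrak g_j$ be the differential of $\sigma_j$ at the identity. Fix left Haar measures on $G$ and all $G_j$, and Lebesgue measures on $\mathfrak g$ and all $\mathfrak g_j$, normalised such that the Radon--Nikodym derivatives at $0$ of the exponential mappings $\exp_G$ and $\exp_{G_j}$ equal $1$, that is, $$\lim_{r\to0+}\frac{|\exp_G(B_r)|_G}{|B_r|_{\mathfrak g}}=1,$$ where $B_r$ is the closed ball of radius $r$ and centre $0$ in $\mathfrak g$ (for some norm), and likewise for each $G_j$.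 For relatively compact open neighbourhoods $U_j$ of the identity in $G_j$, let $\mathbf{BL}(G,\boldsymbol\sigma,\boldsymbol p;\boldsymbol U)\in[0,\infty]$ be the smallest $C$ such that $$\Bigl|\int_G\prod_{j}f_j(\sigma_j(x))\,\mathrm dx\Bigr|\le C\prod_{j}\|f_j\|_{L^{p_j}(G_j)}$$ for all $f_j\in C_c(G_j)$ with $\operatorname{supp}(f_j)\subseteq U_j$ (the integrand on the left being integrable), and let the local Brascamp--Lieb constant $\mathbf{BL}^{\mathrm{loc}}(G,\boldsymbol\sigma,\boldsymbol p)$ be the infimum of $\mathbf{BL}(G,\boldsymbol\sigma,\boldsymbol p;\boldsymbol U)$ over all such $\boldsymbol U=U_1\times\dots\times U_J$. Define $\mathbf{BL}^{\mathrm{loc}}(\mathfrak g,\boldsymbol{\mathrm d\sigma},\boldsymbol p)$ in the same way for the additive groups $\mathfrak g$, $\mathfrak g_j$ and the linear maps $\mathrm d\sigma_j$, with neighbourhoods of $0$ in $\mathfrak g_j$. Then $$\mathbf{BL}^{\mathrm{loc}}(G,\boldsymbol\sigma,\boldsymbol p)=\mathbf{BL}^{\mathrm{loc}}(\mathfrak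 g,\boldsymbol{\mathrm d\sigma},\boldsymbol p)$$ (both sides may be $\infty$). -/

import Mathlib

open MeasureTheory Filter Topology Set
open scoped Manifold ContDiff ENNReal

noncomputable section

/-! ### Brascamp–Lieb constants -/

namespace BrascampLieb

variable {ι : Type*} {Y : Type*} [TopologicalSpace Y] [MeasurableSpace Y]
  {X : ι → Type*} [∀ j, TopologicalSpace (X j)] [∀ j, MeasurableSpace (X j)]

/-- `C` is admissible in the Brascamp–Lieb inequality
`|∫ ∏ j, f j (σ j x) dx| ≤ C * ∏ j, ‖f j‖_{L^{p j}}` for all `f j ∈ C_c (X j)` with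
`supp (f j) ⊆ U j`; the integrand on the left is required to be integrable. -/
def IsBound [Fintype ι] (μ : Measure Y) (ν : ∀ j, Measure (X j)) (σ : ∀ j, Y → X j) (p : ι → ℝ≥0∞)
    (U : ∀ j, Set (X j)) (C : ℝ≥0∞) : Prop :=
  ∀ f : ∀ j, X j → ℂ, (∀ j, Continuous (f j)) → (∀ j, HasCompactSupport (f j)) →
    (∀ j, tsupport (f j) ⊆ U j) →
    Integrable (fun x => ∏ j, f j (σ j x)) μ ∧
      ‖∫ x, ∏ j, f j (σ j x) ∂μ‖ₑ ≤ C * ∏ j, eLpNorm (f j) (p j) (ν j)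

/-- The best constant `BL(Y, σ, p; U)` for inputs supported in `U` (`∞` if there is none). -/
def const [Fintype ι] (μ : Measure Y) (ν : ∀ j, Measure (X j)) (σ : ∀ j, Y → X j) (p : ι → ℝ≥0∞)
    (U : ∀ j, Set (X j)) : ℝ≥0∞ :=
  sInf {C : ℝ≥0∞ | IsBound μ ν σ p U C}

/-- The local Brascamp–Lieb constant: the infimum of `BL(Y, σ, p; U)` over all families of
relatively compact open neighbourhoods `U j` of the base points `e j` (for groups, the identities). -/
def localConst [Fintype ι] (μ : Measure Y) (ν : ∀ j, Measure (X j)) (σ : ∀ j, Y → X j) (p : ι → ℝ≥0∞)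
    (e : ∀ j, X j) : ℝ≥0∞ :=
  ⨅ U ∈ {U : ∀ j, Set (X j) | ∀ j, IsOpen (U j) ∧ e j ∈ U j ∧ IsCompact (closure (U j))},
    const μ ν σ p U

/-- A datum `σ j : G → H j` is canonical when `σ = (σ j)` is an isomorphism of topological groups
from `G` onto a closed subgroup of the product group `∏ j, H j`; under this identification
`σ j` is the restriction to `G` of the projection of the product onto `H j`. -/
def IsCanonical {G : Type*} [Group G] [TopologicalSpace G] {H : ι → Type*} [∀ j, Group (H j)]
    [∀ j, TopologicalSpace (H j)] (σ : ∀ j, G →* H j) : Prop :=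
  IsClosedEmbedding (fun (x : G) (j : ι) => σ j x)

/-- Closed subgroups of a product, with the restricted projections, are canonical data. -/
theorem isCanonical_of_isClosed {H : ι → Type*} [∀ j, Group (H j)] [∀ j, TopologicalSpace (H j)]
    (K : Subgroup (∀ j, H j)) (hK : IsClosed (K : Set (∀ j, H j))) :
    IsCanonical (fun j => (Pi.evalMonoidHom H j).comp K.subtype) :=
  hK.isClosedEmbedding_subtypeVal

end BrascampLieb

/-! ### The exponential mapping of a Lie group and its Radon–Nikodym derivative -/

namespace LieExp

variable {E : Type*} [NormedAddCommGroup E] [NormedSpace ℝ E]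
  {G : Type*} [TopologicalSpace G] [ChartedSpace E G] [Group G]

/-- The Borel σ-algebra of the Lie algebra. -/
instance instMeasurableSpaceLie : MeasurableSpace (GroupLieAlgebra 𝓘(ℝ, E) G) := borel _

instance instBorelSpaceLie : BorelSpace (GroupLieAlgebra 𝓘(ℝ, E) G) := ⟨rfl⟩

/-- The left-invariant vector field of `v` has a complete integral curve through the identity. -/
theorem exists_integralCurve [FiniteDimensional ℝ E] [LieGroup 𝓘(ℝ, E) ∞ G] [T2Space G]
    (v : GroupLieAlgebra 𝓘(ℝ, E) G) :
    ∃ γ : ℝ → G, γ 0 = 1 ∧ IsMIntegralCurve (I := 𝓘(ℝ, E)) γ (mulInvariantVectorField v) := by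
  have : CompleteSpace E := FiniteDimensional.complete ℝ E
  have h3 : LieGroup 𝓘(ℝ, E) (minSmoothness ℝ 3) G :=
    LieGroup.of_le (n := ∞) (by
      rw [minSmoothness_of_isRCLikeNormedField]; exact ENat.LEInfty.out)
  have h1 : IsManifold 𝓘(ℝ, E) 1 G := IsManifold.of_le (n := ∞) (by simp)
  have hv := (contMDiff_mulInvariantVectorField (I := 𝓘(ℝ, E)) v).of_le
    (show (1 : ℕ∞ω) ≤ minSmoothness ℝ 2 by simp)
  obtain ⟨γ, hγ0, hγ⟩ := exists_isMIntegralCurveAt_of_contMDiffAt_boundaryless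
    (t₀ := 0) (hv.contMDiffAt (x := 1))
  obtain ⟨ε, hε, hγ⟩ := isMIntegralCurveAt_iff'.1 hγ
  refine exists_isMIntegralCurve_of_isMIntegralCurveOn hv hε (fun g => ⟨fun t => g * γ t, ?_, ?_⟩) 1
  · simp [hγ0]
  · intro t ht
    have hb : Ioo (-ε) ε = Metric.ball (0 : ℝ) ε := by rw [Real.ball_eq_Ioo, zero_sub, zero_add]
    rw [hb] at ht ⊢
    have hL : ∀ a b : G, MDifferentiableAt 𝓘(ℝ, E) 𝓘(ℝ, E) (fun x => a * x) b := fun a b =>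
      (contMDiff_mul_left (I := 𝓘(ℝ, E)) (n := ∞) (a := a)).contMDiffAt.mdifferentiableAt (by simp)
    refine ((hL g (γ t)).hasMFDerivAt.comp_hasMFDerivWithinAt t (hγ t ht)).congr_mfderiv ?_
    have key : ∀ b c : G, b * 1 = c → ∀ w : E,
        (mfderiv 𝓘(ℝ, E) 𝓘(ℝ, E) (fun x => g * x) c : E →L[ℝ] E)
          ((mfderiv 𝓘(ℝ, E) 𝓘(ℝ, E) (fun x => b * x) 1 : E →L[ℝ] E) w) =
        (mfderiv 𝓘(ℝ, E) 𝓘(ℝ, E) (fun x => g * b * x) 1 : E →L[ℝ] E) w := by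
      rintro b c rfl w
      have hcomp : (fun x => g * b * x) = (fun x => g * x) ∘ (fun x => b * x) := by
        ext x; simp [mul_assoc]
      rw [hcomp, mfderiv_comp (I := 𝓘(ℝ, E)) (I' := 𝓘(ℝ, E)) (I'' := 𝓘(ℝ, E)) (1 : G)
        (g := fun x => g * x) (f := fun x => b * x) (hL g _) (hL b 1)]
      rfl
    refine ContinuousLinearMap.ext fun a => ?_
    have hk := key (γ t) (γ t) (mul_one _) v
    have h4 := (mfderiv 𝓘(ℝ, E) 𝓘(ℝ, E) (fun x => g * x) (γ t) : E →L[ℝ] E).map_smul (a : ℝ)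
      ((mfderiv 𝓘(ℝ, E) 𝓘(ℝ, E) (fun x => γ t * x) 1 : E →L[ℝ] E) v)
    rw [hk] at h4
    exact h4

/-- The exponential mapping `v ↦ γ 1`, where `γ` is the integral curve of the left-invariant vector
field of `v` with `γ 0 = 1`. -/
def lieExp [FiniteDimensional ℝ E] [LieGroup 𝓘(ℝ, E) ∞ G] [T2Space G]
    (v : GroupLieAlgebra 𝓘(ℝ, E) G) : G :=
  (exists_integralCurve v).choose 1

/-- Closed balls of the Lie algebra, for the norm of the model space. -/
def lieBall (v : GroupLieAlgebra 𝓘(ℝ, E) G) (r : ℝ) : Set (GroupLieAlgebra 𝓘(ℝ, E) G) :=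
  Metric.closedBall (α := E) v r

/-- The Radon–Nikodym derivative of the exponential mapping, for the measure `μ` on the group and
the measure `ν` on the Lie algebra, takes the value `c` at `v`: this is the derivative at `v` of
the set function `A ↦ μ (exp A)` with respect to `ν`, as the limit of the ratios on balls shrinking
to `v`. Where `exp` is a local diffeomorphism, `A ↦ μ (exp A)` is locally a measure with a
continuous density with respect to `ν`, and `c` is the value of this density at `v`. -/
def HasRNDerivAt [FiniteDimensional ℝ E] [LieGroup 𝓘(ℝ, E) ∞ G] [T2Space G] [MeasurableSpace G]
    (μ : Measure G) (ν : Measure (GroupLieAlgebra 𝓘(ℝ, E) G))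
    (v : GroupLieAlgebra 𝓘(ℝ, E) G) (c : ℝ≥0∞) : Prop :=
  Tendsto (fun r : ℝ => μ (lieExp '' lieBall v r) / ν (lieBall v r)) (𝓝[>] 0) (𝓝 c)

/-- The differential at the identity, `dσ : 𝔤 → 𝔥`, of a homomorphism of Lie groups. -/
def differential {F : Type*} [NormedAddCommGroup F] [NormedSpace ℝ F]
    {H : Type*} [TopologicalSpace H] [ChartedSpace F H] [Group H] (σ : G →* H) :
    GroupLieAlgebra 𝓘(ℝ, E) G →L[ℝ] GroupLieAlgebra 𝓘(ℝ, F) H :=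
  mfderiv 𝓘(ℝ, E) 𝓘(ℝ, F) σ 1

end LieExp

end

/-! ### Transport of Brascamp–Lieb inequalities by local homeomorphisms -/

namespace BrascampLieb

variable {ι : Type*} [Fintype ι]
  {Y : Type*} [TopologicalSpace Y] [MeasurableSpace Y]
  {X : ι → Type*} [∀ j, TopologicalSpace (X j)] [∀ j, MeasurableSpace (X j)]
  {Y' : Type*} [TopologicalSpace Y'] [MeasurableSpace Y']
  {X' : ι → Type*} [∀ j, TopologicalSpace (X' j)] [∀ j, MeasurableSpace (X' j)]

/-! Near the identity the exponential mappings intertwine `σ j` with its differential, and on small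
neighbourhoods they distort the measure of every measurable set by at most a factor `κ`, for any
prescribed `κ > 1`. Transporting inputs through them costs one factor `κ` for the integral and at
most one for each norm. So each local constant is at most `κ ^ (card ι + 1)` times the other, and `κ
→ 1` gives equality (`localConst_le_mul`, `localConst_eq_of_isExpChart`). Inputs are replaced by
their absolute values, so that one-sided inequalities between measures suffice and no change of
variables formula is needed.

Canonicity localises the integrals. Since `σ` is an embedding, a point all of whose images `σ j y`
are near the identity is itself near the identity. The linear datum has the same property because
the differentials are jointly injective (`injective_of_isExpChart`).

No Jacobian of the exponential mapping is computed. The group law in exponential coordinates is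
strictly differentiable at the origin with derivative addition, so left translations are nearly
translations. Left invariance carries the normalisation at `0` to all small balls with centres near
`0`, and a Besicovitch covering argument passes from balls to measurable sets (`exists_measure_le`).

Homomorphisms are linear in exponential coordinates: they respect integer multiples, and the
first-order product formula gives additivity. The coordinates themselves come from the equation of
left-invariant fields in a chart: its flow is strictly differentiable in the initial velocity at
`0`, and the inverse function theorem applies (`exists_isExpChart`). -/

theorem IsBound.mono_set {Y : Type*} [MeasurableSpace Y] {μ : Measure Y}
    {ν : ∀ j, Measure (X j)} {σ : ∀ j, Y → X j} {p : ι → ℝ≥0∞} {U V : ∀ j, Set (X j)} {C : ℝ≥0∞}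
    (h : IsBound μ ν σ p V C)
    (hUV : ∀ j, U j ⊆ V j) : IsBound μ ν σ p U C :=
  fun f hf hc hs => h f hf hc fun j => (hs j).trans (hUV j)

/-- The absolute value of a function on the target of a local homeomorphism, pulled back to its
source and extended by zero. -/
noncomputable def pullbackNorm {A B : Type*} [TopologicalSpace A] [TopologicalSpace B]
    (θ : OpenPartialHomeomorph A B) (f : B → ℂ) : A → ℂ :=
  θ.source.indicator fun x => (‖f (θ x)‖ : ℂ)

section pullbackNorm

variable {A B : Type*} [TopologicalSpace A] [TopologicalSpace B]
  (θ : OpenPartialHomeomorph A B) {f : B → ℂ}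

theorem pullbackNorm_of_mem {x : A} (hx : x ∈ θ.source) :
    pullbackNorm θ f x = (‖f (θ x)‖ : ℂ) := indicator_of_mem hx _

theorem isCompact_symm_image_tsupport (hc : HasCompactSupport f) (hs : tsupport f ⊆ θ.target) :
    IsCompact (θ.symm '' tsupport f) :=
  hc.isCompact.image_of_continuousOn (θ.continuousOn_symm.mono hs)

theorem pullbackNorm_eq_zero {x : A} (hx : x ∉ θ.symm '' tsupport f) :
    pullbackNorm θ f x = 0 := by
  by_cases h : x ∈ θ.source
  · rw [pullbackNorm_of_mem θ h]
    have : θ x ∉ tsupport f := fun h' => hx ⟨θ x, h', θ.left_inv h⟩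
    simp [image_eq_zero_of_notMem_tsupport this]
  · exact indicator_of_notMem h _

theorem tsupport_pullbackNorm_subset [T2Space A] (hc : HasCompactSupport f)
    (hs : tsupport f ⊆ θ.target) : tsupport (pullbackNorm θ f) ⊆ θ.symm '' tsupport f := by
  refine closure_minimal (fun x hx => ?_) (isCompact_symm_image_tsupport θ hc hs).isClosed
  by_contra h
  exact hx (pullbackNorm_eq_zero θ h)

theorem hasCompactSupport_pullbackNorm [T2Space A] (hc : HasCompactSupport f)
    (hs : tsupport f ⊆ θ.target) : HasCompactSupport (pullbackNorm θ f) :=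
  (isCompact_symm_image_tsupport θ hc hs).of_isClosed_subset (isClosed_tsupport _)
    (tsupport_pullbackNorm_subset θ hc hs)

/-- Extension by zero creates no jump: the transported support is compact, hence closed in the
Hausdorff space `A`, so the function vanishes on a neighbourhood of every point outside the source.
-/
theorem continuous_pullbackNorm [T2Space A] (hf : Continuous f) (hc : HasCompactSupport f)
    (hs : tsupport f ⊆ θ.target) : Continuous (pullbackNorm θ f) := by
  refine continuous_iff_continuousAt.2 fun x => ?_
  by_cases h : x ∈ θ.source
  · have h1 : ContinuousAt (fun x => (‖f (θ x)‖ : ℂ)) x :=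
      (Complex.continuous_ofReal.comp (continuous_norm.comp hf)).continuousAt.comp
        (θ.continuousAt h)
    refine h1.congr ?_
    filter_upwards [θ.open_source.mem_nhds h] with y hy
    exact (pullbackNorm_of_mem θ hy).symm
  · have hK := (isCompact_symm_image_tsupport θ hc hs).isClosed
    have hx : x ∉ θ.symm '' tsupport f := by
      rintro ⟨y, hy, rfl⟩
      exact h (θ.map_target (hs hy))
    refine (continuousAt_const (y := (0 : ℂ))).congr ?_
    filter_upwards [hK.isOpen_compl.mem_nhds hx] with y hy
    exact (pullbackNorm_eq_zero θ hy).symm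

end pullbackNorm

section distortion

variable {A B : Type*} [TopologicalSpace A] [MeasurableSpace A] [BorelSpace A]
  [TopologicalSpace B] [MeasurableSpace B] [BorelSpace B]

theorem aemeasurable_restrict_source (θ : OpenPartialHomeomorph A B) (μ : Measure A) :
    AEMeasurable θ (μ.restrict θ.source) :=
  θ.continuousOn.aemeasurable θ.open_source.measurableSet

theorem measurableSet_source_inter_preimage (θ : OpenPartialHomeomorph A B) {s : Set B}
    (hs : MeasurableSet s) : MeasurableSet (θ.source ∩ θ ⁻¹' s) := by
  have h1 : Measurable (θ.source.domRestrict θ) := θ.continuousOn.domRestrict.measurable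
  have h2 := (MeasurableEmbedding.subtype_coe θ.open_source.measurableSet).measurableSet_image.2
    (h1 hs)
  convert h2 using 1
  ext x
  simp [Set.domRestrict, and_comm]

theorem measure_target_le {θ : OpenPartialHomeomorph A B} {μ : Measure A} {ν : Measure B}
    {κ : ℝ≥0∞} (h : ∀ s ⊆ θ.source, MeasurableSet s → ν (θ '' s) ≤ κ * μ s) :
    ∀ s ⊆ θ.target, MeasurableSet s → ν s ≤ κ * μ (θ.symm '' s) := by
  intro s hs hm
  have h1 := θ.symm_image_eq_source_inter_preimage hs
  have h2 := h _ inter_subset_left (measurableSet_source_inter_preimage θ hm)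
  rw [← h1, ← image_comp] at h2
  have h3 : (θ ∘ θ.symm) '' s = s := by
    conv_rhs => rw [← image_id s]
    exact image_congr fun x hx => θ.right_inv (hs hx)
  rwa [h3] at h2

/-- A bound on the distortion of measures of sets, as an inequality for the push-forward. -/
theorem map_restrict_source_le {θ : OpenPartialHomeomorph A B} {μ : Measure A} {ν : Measure B}
    {κ : ℝ≥0∞} (h : ∀ s ⊆ θ.source, MeasurableSet s → μ s ≤ κ * ν (θ '' s)) :
    (μ.restrict θ.source).map θ ≤ κ • ν := by
  refine Measure.le_iff.2 fun s hs => ?_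
  have hm : NullMeasurableSet (θ ⁻¹' s) (μ.restrict θ.source) :=
    (aemeasurable_restrict_source θ μ).nullMeasurableSet_preimage hs
  have hm' := measurableSet_source_inter_preimage θ hs
  rw [Measure.map_apply_of_aemeasurable (aemeasurable_restrict_source θ μ) hs,
    Measure.restrict_apply₀ hm, inter_comm]
  refine (h _ inter_subset_left hm').trans ?_
  rw [Measure.smul_apply, smul_eq_mul]
  gcongr
  rintro _ ⟨x, hx, rfl⟩
  exact hx.2

/-- Scaling a measure by `κ` scales the norm by `κ ^ (1 / p)`, which is at most `κ` because `κ` and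
`p` are at least `1`. For `p = ∞` the exponent is `0`. -/
theorem eLpNorm_pullbackNorm_le {θ : OpenPartialHomeomorph A B} {μ : Measure A} {ν : Measure B}
    {κ : ℝ≥0∞} (hκ : 1 ≤ κ) (h : ∀ s ⊆ θ.source, MeasurableSet s → μ s ≤ κ * ν (θ '' s))
    {p : ℝ≥0∞} (hp : 1 ≤ p) {f : B → ℂ} (hf : Continuous f) :
    eLpNorm (pullbackNorm θ f) p μ ≤ κ * eLpNorm f p ν := by
  have hg : Continuous fun x => (‖f x‖ : ℂ) := Complex.continuous_ofReal.comp hf.norm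
  calc eLpNorm (pullbackNorm θ f) p μ
      = eLpNorm ((fun x => (‖f x‖ : ℂ)) ∘ θ) p (μ.restrict θ.source) :=
        eLpNorm_indicator_eq_eLpNorm_restrict θ.open_source.measurableSet
    _ = eLpNorm (fun x => (‖f x‖ : ℂ)) p ((μ.restrict θ.source).map θ) :=
        (eLpNorm_map_measure hg.aestronglyMeasurable (aemeasurable_restrict_source θ μ)).symm
    _ = eLpNorm f p ((μ.restrict θ.source).map θ) :=
        eLpNorm_congr_norm_ae (.of_forall fun x => by simp)
    _ ≤ eLpNorm f p (κ • ν) := eLpNorm_mono_measure f (map_restrict_source_le h)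
    _ ≤ κ * eLpNorm f p ν := by
        have h0 : κ ≠ 0 := (zero_lt_one.trans_le hκ).ne'
        rw [eLpNorm_smul_measure_of_ne_zero h0, smul_eq_mul]
        gcongr
        calc κ ^ (1 / p).toReal ≤ κ ^ (1 : ℝ) := by
              refine ENNReal.rpow_le_rpow_of_exponent_le hκ ?_
              rw [← ENNReal.toReal_one]
              refine ENNReal.toReal_mono ENNReal.one_ne_top ?_
              simpa using hp
          _ = κ := ENNReal.rpow_one κ

/-- A one-sided substitute for the change of variables formula, sufficient for nonnegative
integrands. -/
theorem setLIntegral_target_comp_symm_le {θ : OpenPartialHomeomorph A B} {μ : Measure A}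
    {ν : Measure B} {κ : ℝ≥0∞} (h : ∀ s ⊆ θ.target, MeasurableSet s → ν s ≤ κ * μ (θ.symm '' s))
    {g : A → ℝ≥0∞} (hg : Measurable g) :
    ∫⁻ y in θ.target, g (θ.symm y) ∂ν ≤ κ * ∫⁻ x, g x ∂μ := by
  have hm := aemeasurable_restrict_source θ.symm ν
  calc ∫⁻ y in θ.target, g (θ.symm y) ∂ν
      = ∫⁻ x, g x ∂((ν.restrict θ.symm.source).map θ.symm) :=
        (lintegral_map' hg.aemeasurable hm).symm
    _ ≤ ∫⁻ x, g x ∂(κ • μ) := lintegral_mono' (map_restrict_source_le h) le_rfl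
    _ = κ * ∫⁻ x, g x ∂μ := by rw [lintegral_smul_measure, smul_eq_mul]

end distortion

variable [BorelSpace Y] [∀ j, BorelSpace (X j)] [BorelSpace Y'] [∀ j, BorelSpace (X' j)]
  [∀ j, T2Space (X j)]
  {μ : Measure Y} {ν : ∀ j, Measure (X j)} {σ : ∀ j, Y → X j}
  {μ' : Measure Y'} {ν' : ∀ j, Measure (X' j)} {σ' : ∀ j, Y' → X' j}
  {p : ι → ℝ≥0∞} {κ : ℝ≥0∞}
  {Θ : OpenPartialHomeomorph Y Y'} {θ : ∀ j, OpenPartialHomeomorph (X j) (X' j)}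

/-- Brascamp–Lieb inequalities are transported by local homeomorphisms that intertwine the data and
distort the measures by a bounded factor. -/
theorem IsBound.transfer {U' : ∀ j, Set (X' j)} {C : ℝ≥0∞}
    (hσ : ∀ j, Continuous (σ j)) (hσ' : ∀ j, Continuous (σ' j)) (hp : ∀ j, 1 ≤ p j)
    (hκ : 1 ≤ κ) (hκ' : κ ≠ ⊤)
    (hU' : ∀ j, U' j ⊆ (θ j).target)
    (hint : ∀ y, (∀ j, σ' j y ∈ U' j) →
      y ∈ Θ.target ∧ ∀ j, σ j (Θ.symm y) = (θ j).symm (σ' j y))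
    (hμ : ∀ s ⊆ Θ.target, MeasurableSet s → μ' s ≤ κ * μ (Θ.symm '' s))
    (hν : ∀ j, ∀ s ⊆ (θ j).source, MeasurableSet s → ν j s ≤ κ * ν' j (θ j '' s))
    (h : IsBound μ ν σ p (fun j => (θ j).symm '' U' j) C) :
    IsBound μ' ν' σ' p U' (κ ^ (Fintype.card ι + 1) * C) := by
  intro f hf hc hs
  set g : ∀ j, X j → ℂ := fun j => pullbackNorm (θ j) (f j) with hg
  have hs' : ∀ j, tsupport (f j) ⊆ (θ j).target := fun j => (hs j).trans (hU' j)
  obtain ⟨hI, hB⟩ := h g (fun j => continuous_pullbackNorm (θ j) (hf j) (hc j) (hs' j))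
    (fun j => hasCompactSupport_pullbackNorm (θ j) (hc j) (hs' j))
    (fun j => (tsupport_pullbackNorm_subset (θ j) (hc j) (hs' j)).trans (image_mono (hs j)))
  have hgc : Continuous fun x => ∏ j, g j (σ j x) := continuous_finsetProd _ fun j _ =>
    (continuous_pullbackNorm (θ j) (hf j) (hc j) (hs' j)).comp (hσ j)
  have hfc : Continuous fun x => ∏ j, f j (σ' j x) := continuous_finsetProd _ fun j _ =>
    (hf j).comp (hσ' j)
  -- The transported inputs are nonnegative reals, so the integral bounded by `hB` is the integral
  -- of the absolute value.
  have hnn : ∀ j x, g j x = ((‖g j x‖ : ℝ) : ℂ) := by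
    intro j x
    by_cases hx : x ∈ (θ j).source
    · simp [hg, pullbackNorm_of_mem (θ j) hx]
    · simp [hg, pullbackNorm, hx]
  have hlint : ∫⁻ x, ‖∏ j, g j (σ j x)‖ₑ ∂μ = ‖∫ x, ∏ j, g j (σ j x) ∂μ‖ₑ := by
    have h1 : ∀ x, ∏ j, g j (σ j x) = ((‖∏ j, g j (σ j x)‖ : ℝ) : ℂ) := by
      intro x
      rw [norm_prod, Complex.ofReal_prod]
      exact Finset.prod_congr rfl fun j _ => hnn j _
    rw [← ofReal_integral_norm_eq_lintegral_enorm hI]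
    conv_rhs => rw [integral_congr_ae (.of_forall h1), integral_complex_ofReal]
    rw [← ofReal_norm, Complex.norm_real,
      Real.norm_of_nonneg (integral_nonneg fun _ => norm_nonneg _)]
  have hbound : ∫⁻ y, ‖∏ j, f j (σ' j y)‖ₑ ∂μ' ≤ κ * ∫⁻ x, ‖∏ j, g j (σ j x)‖ₑ ∂μ := by
    refine le_trans ?_ (setLIntegral_target_comp_symm_le hμ hgc.enorm.measurable)
    rw [← lintegral_indicator Θ.open_target.measurableSet]
    refine lintegral_mono fun y => ?_
    -- Outside this set some factor vanishes; inside it `hint` identifies the two integrands.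
    by_cases hy : ∀ j, σ' j y ∈ U' j
    · obtain ⟨h1, h2⟩ := hint y hy
      rw [indicator_of_mem h1]
      simp only [← ofReal_norm, norm_prod]
      refine (congrArg _ (Finset.prod_congr rfl fun j _ => ?_)).le
      have h3 := hU' j (hy j)
      rw [h2 j, hg]
      simp only
      rw [pullbackNorm_of_mem _ ((θ j).map_target h3), (θ j).right_inv h3]
      simp
    · push Not at hy
      obtain ⟨j, hj⟩ := hy
      have h0 : f j (σ' j y) = 0 := image_eq_zero_of_notMem_tsupport fun h => hj (hs j h)
      simp only
      rw [Finset.prod_eq_zero (Finset.mem_univ j) h0]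
      simp
  have hfin : ∫⁻ y, ‖∏ j, f j (σ' j y)‖ₑ ∂μ' < ⊤ :=
    hbound.trans_lt (ENNReal.mul_lt_top hκ'.lt_top hI.2)
  refine ⟨⟨hfc.aestronglyMeasurable, hfin⟩, ?_⟩
  calc ‖∫ y, ∏ j, f j (σ' j y) ∂μ'‖ₑ ≤ ∫⁻ y, ‖∏ j, f j (σ' j y)‖ₑ ∂μ' :=
        enorm_integral_le_lintegral_enorm _
    _ ≤ κ * ‖∫ x, ∏ j, g j (σ j x) ∂μ‖ₑ := hbound.trans_eq (by rw [hlint])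
    _ ≤ κ * (C * ∏ j, eLpNorm (g j) (p j) (ν j)) := by gcongr
    _ ≤ κ * (C * ∏ j, (κ * eLpNorm (f j) (p j) (ν' j))) := by
        gcongr with j
        exact eLpNorm_pullbackNorm_le hκ (hν j) (hp j) (hf j)
    -- One factor `κ` comes from the integral and one from each norm.
    _ = κ ^ (Fintype.card ι + 1) * C * ∏ j, eLpNorm (f j) (p j) (ν' j) := by
        rw [Finset.prod_mul_distrib, Finset.prod_const, Finset.card_univ, pow_succ]
        ring

/-- Local Brascamp–Lieb constants of data that are intertwined by local homeomorphisms are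
comparable, with a factor that is a power of the distortion of the measures. -/
theorem localConst_le_mul [∀ j, T2Space (X' j)] [∀ j, LocallyCompactSpace (X' j)]
    {e : ∀ j, X j} {e' : ∀ j, X' j}
    (hσ : ∀ j, Continuous (σ j)) (hσ' : ∀ j, Continuous (σ' j)) (hp : ∀ j, 1 ≤ p j)
    (hκ : 1 ≤ κ) (hκ' : κ ≠ ⊤)
    (he : ∀ j, e j ∈ (θ j).source) (hee' : ∀ j, θ j (e j) = e' j)
    {W : ∀ j, Set (X' j)} (hW : ∀ j, W j ∈ 𝓝 (e' j))
    (hWΘ : ∀ y, (∀ j, σ' j y ∈ W j) → y ∈ Θ.target)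
    (hint : ∀ y ∈ Θ.target, ∀ j, σ' j y ∈ (θ j).target → σ j (Θ.symm y) = (θ j).symm (σ' j y))
    (hμ : ∀ s ⊆ Θ.target, MeasurableSet s → μ' s ≤ κ * μ (Θ.symm '' s))
    (hν : ∀ j, ∀ s ⊆ (θ j).source, MeasurableSet s → ν j s ≤ κ * ν' j (θ j '' s)) :
    localConst μ' ν' σ' p e' ≤ κ ^ (Fintype.card ι + 1) * localConst μ ν σ p e := by
  have hc : κ ^ (Fintype.card ι + 1) ≠ ⊤ := ENNReal.pow_ne_top hκ'
  have hc0 : κ ^ (Fintype.card ι + 1) ≠ 0 := pow_ne_zero _ (zero_lt_one.trans_le hκ).ne'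
  have key : ∀ U : ∀ j, Set (X j),
      (∀ j, IsOpen (U j) ∧ e j ∈ U j ∧ IsCompact (closure (U j))) → ∀ C, IsBound μ ν σ p U C →
        localConst μ' ν' σ' p e' ≤ κ ^ (Fintype.card ι + 1) * C := by
    intro U hU C hC
    have hnhds : ∀ j, W j ∩ ((θ j).target ∩ (θ j).symm ⁻¹' (U j)) ∈ 𝓝 (e' j) := by
      intro j
      have ht : e' j ∈ (θ j).target := hee' j ▸ (θ j).map_source (he j)
      have hs : (θ j).symm (e' j) = e j := by rw [← hee' j, (θ j).left_inv (he j)]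
      refine inter_mem (hW j) (inter_mem ((θ j).open_target.mem_nhds ht) ?_)
      refine ((θ j).continuousAt_symm ht).preimage_mem_nhds ?_
      rw [hs]
      exact (hU j).1.mem_nhds (hU j).2.1
    -- The interiors of these compact neighbourhoods are the admissible sets on the primed side.
    choose K hK hKs hKc using fun j => local_compact_nhds (hnhds j)
    have hsub : ∀ j, interior (K j) ⊆ W j ∩ ((θ j).target ∩ (θ j).symm ⁻¹' (U j)) :=
      fun j => interior_subset.trans (hKs j)
    have hB : IsBound μ' ν' σ' p (fun j => interior (K j)) (κ ^ (Fintype.card ι + 1) * C) := by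
      refine IsBound.transfer (Θ := Θ) (θ := θ) hσ hσ' hp hκ hκ' (fun j => (hsub j).trans
        (inter_subset_right.trans inter_subset_left)) (fun y hy => ?_) hμ hν
        (hC.mono_set fun j => ?_)
      · have h1 := hWΘ y fun j => (hsub j (hy j)).1
        exact ⟨h1, fun j => hint y h1 j (hsub j (hy j)).2.1⟩
      · rintro _ ⟨x, hx, rfl⟩
        exact (hsub j hx).2.2
    refine (iInf₂_le (fun j => interior (K j)) fun j => ⟨isOpen_interior,
      mem_interior_iff_mem_nhds.2 (hK j), (hKc j).of_isClosed_subset isClosed_closure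
        (closure_minimal interior_subset (hKc j).isClosed)⟩).trans (sInf_le hB)
  -- The factor is nonzero and finite, so it can be divided out and the infima treated one bound at
  -- a time.
  rw [mul_comm, ← ENNReal.div_le_iff hc0 hc]
  refine le_iInf₂ fun U hU => le_sInf fun C hC => ?_
  rw [ENNReal.div_le_iff hc0 hc, mul_comm]
  exact key U hU C hC

end BrascampLieb

/-! ### Exponential coordinates and the distortion of measures -/

namespace LieExp

/-- Exponential coordinates of a topological group: a local homeomorphism at `0` which restricts to
a one-parameter subgroup on every line, and in which the multiplication is strictly differentiable
at the identity, with derivative the addition. -/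
structure IsExpChart {E G : Type*} [NormedAddCommGroup E] [NormedSpace ℝ E] [TopologicalSpace G]
    [Group G] (e : OpenPartialHomeomorph E G) : Prop where
  zero_mem : (0 : E) ∈ e.source
  add_smul : ∀ (s t : ℝ) (v : E), e ((s + t) • v) = e (s • v) * e (t • v)
  strict : HasStrictFDerivAt (fun p : E × E => e.symm (e p.1 * e p.2))
    (ContinuousLinearMap.fst ℝ E E + ContinuousLinearMap.snd ℝ E E) 0

namespace IsExpChart

variable {E G : Type*} [NormedAddCommGroup E] [NormedSpace ℝ E] [TopologicalSpace G] [Group G]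
  {e : OpenPartialHomeomorph E G}

theorem map_zero (he : IsExpChart e) : e 0 = 1 := by
  have h := he.add_smul 0 0 0
  simpa using h

theorem map_neg_mul (he : IsExpChart e) (v : E) : e (-v) * e v = 1 := by
  have h := he.add_smul (-1) 1 v
  simpa [he.map_zero] using h.symm

theorem map_nsmul (he : IsExpChart e) (n : ℕ) (v : E) : e (n • v) = e v ^ n := by
  induction n with
  | zero => simp [he.map_zero]
  | succ n ih =>
    have h := he.add_smul n 1 v
    rw [one_smul, Nat.cast_smul_eq_nsmul, ih] at h
    rw [pow_succ, ← h, ← Nat.cast_smul_eq_nsmul ℝ, Nat.cast_succ]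

theorem symm_one (he : IsExpChart e) : e.symm 1 = 0 := by
  rw [← he.map_zero, e.left_inv he.zero_mem]

theorem one_mem (he : IsExpChart e) : (1 : G) ∈ e.target :=
  he.map_zero ▸ e.map_source he.zero_mem

theorem continuousAt_zero (he : IsExpChart e) : ContinuousAt e 0 := e.continuousAt he.zero_mem

theorem eventually_mul_mem_target [ContinuousMul G] (he : IsExpChart e) :
    ∀ᶠ p : E × E in 𝓝 0, e p.1 * e p.2 ∈ e.target := by
  have h : ContinuousAt (fun p : E × E => e p.1 * e p.2) 0 :=
    (he.continuousAt_zero.comp (f := Prod.fst) (x := (0 : E × E)) continuousAt_fst).mul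
      (he.continuousAt_zero.comp (f := Prod.snd) (x := (0 : E × E)) continuousAt_snd)
  refine h.eventually (e.open_target.mem_nhds ?_)
  simp [he.map_zero, he.one_mem]

/-- Left translations are Lipschitz close to translations in exponential coordinates. -/
theorem exists_log_mul_bound [ContinuousMul G] (he : IsExpChart e) {ε : ℝ} (hε : 0 < ε) :
    ∃ δ > 0, Metric.ball 0 δ ⊆ e.source ∧ ∀ x ∈ Metric.ball (0 : E) δ, ∀ w ∈ Metric.ball (0 : E) δ,
      e x * e w ∈ e.target ∧ ∀ w' ∈ Metric.ball (0 : E) δ,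
        ‖e.symm (e x * e w) - e.symm (e x * e w')‖ ≤ (1 + ε) * ‖w - w'‖ := by
  have h1 := he.strict.isLittleO.def hε
  rw [nhds_prod_eq, Filter.Eventually, mem_prod_same_iff] at h1
  obtain ⟨s, hs, h1⟩ := h1
  obtain ⟨δ, hδ, h2⟩ := Metric.mem_nhds_iff.1 (inter_mem hs he.eventually_mul_mem_target)
  obtain ⟨δ', hδ', h3⟩ := Metric.mem_nhds_iff.1 (e.open_source.mem_nhds he.zero_mem)
  have hmem : ∀ x ∈ Metric.ball (0 : E) (min δ δ'), ∀ w ∈ Metric.ball (0 : E) (min δ δ'),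
      (x, w) ∈ Metric.ball (0 : E × E) δ := by
    intro x hx w hw
    rw [Metric.mem_ball, dist_zero_right, Prod.norm_mk]
    rw [mem_ball_zero_iff] at hx hw
    exact max_lt (hx.trans_le (min_le_left _ _)) (hw.trans_le (min_le_left _ _))
  refine ⟨min δ δ', lt_min hδ hδ', (Metric.ball_subset_ball (min_le_right _ _)).trans h3,
    fun x hx w hw => ⟨(h2 (hmem x hx w hw)).2, fun w' hw' => ?_⟩⟩
  have h4 := h1 (mk_mem_prod (h2 (hmem x hx w hw)).1 (h2 (hmem x hx w' hw')).1)
  -- Both points have first coordinate `x`, so the derivative sees only `w - w'`. Strictness allows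
  -- both of them to differ from the origin.
  have h5 : (ContinuousLinearMap.fst ℝ E E + ContinuousLinearMap.snd ℝ E E)
      ((x, w) - (x, w')) = w - w' := by simp
  rw [Set.mem_ofPred_eq, h5, Prod.mk_sub_mk, sub_self, Prod.norm_mk, norm_zero,
    max_eq_right (norm_nonneg _)] at h4
  calc _ ≤ ‖e.symm (e x * e w) - e.symm (e x * e w') - (w - w')‖ + ‖w - w'‖ :=
        norm_le_norm_sub_add _ _
    _ ≤ _ := by linarith

/-- The first inclusion translates by `e (-x)` and compares `y` with `x`, which goes to `0`; the
second translates by `e x` and compares `w` with `0`. -/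
theorem image_closedBall_subset [ContinuousMul G] (he : IsExpChart e) {ε : ℝ} (hε : 0 < ε) :
    ∃ δ > 0, Metric.ball 0 δ ⊆ e.source ∧ ∀ x ∈ Metric.ball (0 : E) δ, ∀ r : ℝ,
      (Metric.closedBall x r ⊆ Metric.ball 0 δ → e '' Metric.closedBall x r ⊆
        (fun g => e x * g) '' (e '' Metric.closedBall 0 ((1 + ε) * r))) ∧
      (Metric.closedBall 0 r ⊆ Metric.ball (0 : E) δ →
        (fun g => e x * g) '' (e '' Metric.closedBall 0 r) ⊆
          e '' Metric.closedBall x ((1 + ε) * r)) := by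
  obtain ⟨δ, hδ, hs, h⟩ := he.exists_log_mul_bound hε
  refine ⟨δ, hδ, hs, fun x hx r => ⟨fun hr => ?_, fun hr => ?_⟩⟩
  · rintro _ ⟨y, hy, rfl⟩
    have hx' : -x ∈ Metric.ball (0 : E) δ := by simpa using hx
    have h1 := h _ hx' y (hr hy)
    refine ⟨_, ⟨e.symm (e (-x) * e y), ?_, rfl⟩, ?_⟩
    · have h2 := h1.2 x hx
      rw [he.map_neg_mul, he.symm_one, sub_zero] at h2
      rw [mem_closedBall_zero_iff]
      refine h2.trans ?_
      rw [Metric.mem_closedBall, dist_eq_norm] at hy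
      gcongr
    · simp only
      rw [e.right_inv h1.1, ← mul_assoc]
      have h3 := he.map_neg_mul (-x)
      rw [neg_neg] at h3
      rw [h3, one_mul]
  · rintro _ ⟨_, ⟨w, hw, rfl⟩, rfl⟩
    have h1 := h x hx w (hr hw)
    refine ⟨e.symm (e x * e w), ?_, e.right_inv h1.1⟩
    have h2 := h1.2 0 (Metric.mem_ball_self hδ)
    rw [he.map_zero, mul_one, e.left_inv (hs hx), sub_zero] at h2
    rw [Metric.mem_closedBall, dist_eq_norm]
    refine h2.trans ?_
    rw [mem_closedBall_zero_iff] at hw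
    gcongr

section measure

variable [IsTopologicalGroup G] [MeasurableSpace G] [BorelSpace G] [FiniteDimensional ℝ E]
  [MeasurableSpace E] [BorelSpace E]

/-- If the Radon–Nikodym derivative at `0` of exponential coordinates is `1`, then the measures of
small balls centred near `0` are distorted by a factor close to `1`. -/
theorem exists_measure_closedBall_le (he : IsExpChart e) (μ : Measure G) [μ.IsMulLeftInvariant]
    (ν : Measure E) [ν.IsAddHaarMeasure]
    (h : Tendsto (fun r : ℝ => μ (e '' Metric.closedBall 0 r) / ν (Metric.closedBall 0 r)) (𝓝[>] 0)
      (𝓝 1)) {θ : ℝ} (hθ : 1 < θ) :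
    ∃ δ > 0, Metric.ball 0 δ ⊆ e.source ∧ ∀ x ∈ Metric.ball (0 : E) δ, ∀ᶠ r : ℝ in 𝓝[>] 0,
      μ (e '' Metric.closedBall x r) ≤
          ENNReal.ofReal (θ ^ (Module.finrank ℝ E + 1)) * ν (Metric.closedBall x r) ∧
        ν (Metric.closedBall x r) ≤
          ENNReal.ofReal (θ ^ (Module.finrank ℝ E + 1)) * μ (e '' Metric.closedBall x r) := by
  have hθ0 : 0 < θ := zero_lt_one.trans hθ
  obtain ⟨δ, hδ, hs, hb⟩ := he.image_closedBall_subset (sub_pos.2 hθ)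
  rw [add_sub_cancel] at hb
  refine ⟨δ, hδ, hs, fun x hx => ?_⟩
  -- In the bound `θ ^ (n + 1)`, `n` factors come from dilating the radius by `θ` and one from the
  -- density at `0`.
  set n := Module.finrank ℝ E
  have hθe : (1 : ℝ≥0∞) < ENNReal.ofReal θ := by simpa using hθ
  have hinv : (ENNReal.ofReal θ)⁻¹ < 1 := ENNReal.inv_lt_one.2 hθe
  have hball : ∀ (y : E) {r : ℝ}, 0 < r → ∀ t : ℝ, 0 < t →
      ν (Metric.closedBall y (t * r)) = ENNReal.ofReal (t ^ n) * ν (Metric.closedBall 0 r) :=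
    fun y r hr t ht => Measure.addHaar_closedBall_mul_of_pos ν y ht r
  have hpos : ∀ r : ℝ, 0 < r → ν (Metric.closedBall (0 : E) r) ≠ 0 := fun r hr =>
    (Metric.measure_closedBall_pos ν 0 hr).ne'
  have hfin : ∀ r : ℝ, ν (Metric.closedBall (0 : E) r) ≠ ⊤ := fun r =>
    (isCompact_closedBall (0 : E) r).measure_ne_top
  have hev : ∀ᶠ r : ℝ in 𝓝[>] 0,
      μ (e '' Metric.closedBall 0 r) ≤ ENNReal.ofReal θ * ν (Metric.closedBall 0 r) ∧
        ν (Metric.closedBall 0 r) ≤ ENNReal.ofReal θ * μ (e '' Metric.closedBall 0 r) := by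
    filter_upwards [h.eventually_lt_const hθe, h.eventually_const_lt hinv, self_mem_nhdsWithin]
      with r h1 h2 hr
    constructor
    · exact (ENNReal.div_le_iff (hpos r hr) (hfin r)).1 h1.le
    · have h3 := (ENNReal.le_div_iff_mul_le (.inl (hpos r hr)) (.inl (hfin r))).1 h2.le
      rwa [mul_comm, ← div_eq_mul_inv, ENNReal.div_le_iff (by simpa using hθ0) (by simp),
        mul_comm] at h3
  have hmulset : ∀ s : Set G, μ ((fun g => e x * g) '' s) = μ s := fun s => by
    rw [image_mul_left, measure_preimage_mul]
  have htend : ∀ t : ℝ, 0 < t → Tendsto (fun r : ℝ => t * r) (𝓝[>] 0) (𝓝[>] 0) := by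
    intro t ht
    refine tendsto_nhdsWithin_iff.2 ⟨?_, ?_⟩
    · have : Tendsto (fun r : ℝ => t * r) (𝓝 0) (𝓝 (t * 0)) := tendsto_id.const_mul t
      rw [mul_zero] at this
      exact this.mono_left nhdsWithin_le_nhds
    · filter_upwards [self_mem_nhdsWithin] with r hr using mul_pos ht hr
  have hx' : ∀ᶠ r : ℝ in 𝓝[>] 0, Metric.closedBall x r ⊆ Metric.ball 0 δ := by
    rw [mem_ball_zero_iff] at hx
    filter_upwards [Ioo_mem_nhdsGT (sub_pos.2 hx)] with r hr
    refine Metric.closedBall_subset_ball' ?_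
    rw [dist_zero_right]
    linarith [hr.2]
  have h0' : ∀ᶠ r : ℝ in 𝓝[>] 0, Metric.closedBall 0 (θ⁻¹ * r) ⊆ Metric.ball (0 : E) δ := by
    refine (htend θ⁻¹ (inv_pos.2 hθ0)).eventually
      (p := fun r => Metric.closedBall 0 r ⊆ Metric.ball (0 : E) δ) ?_
    filter_upwards [Ioo_mem_nhdsGT hδ] with r hr using Metric.closedBall_subset_ball hr.2
  filter_upwards [hx', h0', (htend θ hθ0).eventually hev,
    (htend θ⁻¹ (inv_pos.2 hθ0)).eventually hev, self_mem_nhdsWithin] with r hr1 hr2 hr3 hr4 hr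
  have hone := hball x hr 1 one_pos
  simp only [one_mul, one_pow, ENNReal.ofReal_one] at hone
  rw [hone]
  constructor
  · calc μ (e '' Metric.closedBall x r)
        ≤ μ (e '' Metric.closedBall 0 (θ * r)) := by
          rw [← hmulset (e '' Metric.closedBall 0 (θ * r))]
          exact measure_mono ((hb x hx r).1 hr1)
      _ ≤ ENNReal.ofReal θ * ν (Metric.closedBall 0 (θ * r)) := hr3.1
      _ = _ := by
          rw [hball 0 hr θ hθ0, ← mul_assoc, ← ENNReal.ofReal_mul hθ0.le, pow_succ']
  -- The lower bound starts from radius `θ⁻¹ * r`, so that the translated image still fits in the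
  -- image of the ball of radius `r` about `x`.
  · have h5 : ν (Metric.closedBall (0 : E) r) =
        ENNReal.ofReal (θ ^ n) * ν (Metric.closedBall 0 (θ⁻¹ * r)) := by
      rw [← hball 0 (mul_pos (inv_pos.2 hθ0) hr) θ hθ0, mul_inv_cancel_left₀ hθ0.ne']
    calc ν (Metric.closedBall (0 : E) r)
        = ENNReal.ofReal (θ ^ n) * ν (Metric.closedBall 0 (θ⁻¹ * r)) := h5
      _ ≤ ENNReal.ofReal (θ ^ n) *
          (ENNReal.ofReal θ * μ (e '' Metric.closedBall 0 (θ⁻¹ * r))) := by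
          gcongr
          exact hr4.2
      _ ≤ ENNReal.ofReal (θ ^ n) * (ENNReal.ofReal θ * μ (e '' Metric.closedBall x r)) := by
          refine mul_le_mul_right (mul_le_mul_right ?_ _) _
          rw [← hmulset (e '' Metric.closedBall 0 (θ⁻¹ * r))]
          refine measure_mono (((hb x hx _).2 hr2).trans ?_)
          rw [mul_inv_cancel_left₀ hθ0.ne']
      _ = _ := by
          rw [← mul_assoc, ← ENNReal.ofReal_mul (by positivity), pow_succ]

/-- If the Radon–Nikodym derivative at `0` of exponential coordinates is `1`, then they distort
measures near `0` by a factor close to `1`. -/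
theorem exists_measure_le [T2Space G] (he : IsExpChart e) (μ : Measure G) [μ.IsMulLeftInvariant]
    [IsFiniteMeasureOnCompacts μ] (ν : Measure E) [ν.IsAddHaarMeasure]
    (h : Tendsto (fun r : ℝ => μ (e '' Metric.closedBall 0 r) / ν (Metric.closedBall 0 r)) (𝓝[>] 0)
      (𝓝 1)) {κ : ℝ≥0∞} (hκ : 1 < κ) (hκ' : κ ≠ ⊤) :
    ∃ δ > 0, Metric.ball 0 δ ⊆ e.source ∧ ∀ s ⊆ Metric.ball (0 : E) δ, MeasurableSet s →
      μ (e '' s) ≤ κ * ν s ∧ ν s ≤ κ * μ (e '' s) := by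
  obtain ⟨θ, hθ, hθκ⟩ : ∃ θ : ℝ, 1 < θ ∧
      ENNReal.ofReal (θ ^ (Module.finrank ℝ E + 1)) ≤ κ := by
    have hc : ContinuousAt (fun θ : ℝ => ENNReal.ofReal (θ ^ (Module.finrank ℝ E + 1))) 1 :=
      (ENNReal.continuous_ofReal.comp (continuous_pow _)).continuousAt
    have h1 : ∀ᶠ θ : ℝ in 𝓝 1, ENNReal.ofReal (θ ^ (Module.finrank ℝ E + 1)) < κ := by
      refine hc.eventually_lt_const ?_
      simpa using hκ
    obtain ⟨θ, h2, h3⟩ := ((h1.filter_mono nhdsWithin_le_nhds).and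
      (self_mem_nhdsWithin (s := Ioi (1 : ℝ)))).exists
    exact ⟨θ, h3, h2.le⟩
  obtain ⟨δ, hδ, hs, hb⟩ := he.exists_measure_closedBall_le μ ν h hθ
  have hδ2 : 0 < δ / 2 := half_pos hδ
  have hsub : Metric.ball (0 : E) (δ / 2) ⊆ Metric.ball 0 δ :=
    Metric.ball_subset_ball (by linarith)
  -- Halving the radius leaves a compact closed ball inside the source, which makes the measure `ρ`
  -- below finite.
  refine ⟨δ / 2, hδ2, hsub.trans hs, ?_⟩
  set V : Set E := Metric.ball 0 (δ / 2) with hV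
  let e' : OpenPartialHomeomorph E G := e.restrOpen V Metric.isOpen_ball
  have hsource : e'.source = V := by
    rw [OpenPartialHomeomorph.restrOpen_source, inter_eq_right.2 (hsub.trans hs)]
  have htarget : e'.target = e '' V := by rw [← e'.image_source_eq_target, hsource]; rfl
  -- Pulling `μ` back to `E` allows two measures on one space to be compared on balls.
  let ρ : Measure E := (μ.restrict e'.target).map e'.symm
  have hρ : ∀ s ⊆ V, MeasurableSet s → ρ s = μ (e '' s) := by
    intro s hsV hm
    have hae := BrascampLieb.aemeasurable_restrict_source e'.symm μ
    change ((μ.restrict e'.symm.source).map e'.symm) s = _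
    rw [Measure.map_apply_of_aemeasurable hae hm,
      Measure.restrict_apply₀ (hae.nullMeasurableSet_preimage hm)]
    congr 1
    ext y
    constructor
    · rintro ⟨h1, h2⟩
      exact ⟨e'.symm y, h1, e'.right_inv h2⟩
    · rintro ⟨x, h1, rfl⟩
      have h2 : x ∈ e'.source := hsource ▸ hsV h1
      refine ⟨?_, e'.map_source h2⟩
      have h3 : e'.symm (e x) = x := e'.left_inv h2
      rwa [mem_preimage, h3]
  have hfin : IsFiniteMeasure ρ := by
    refine ⟨?_⟩
    have hae := BrascampLieb.aemeasurable_restrict_source e'.symm μ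
    change ((μ.restrict e'.symm.source).map e'.symm) univ < ⊤
    rw [Measure.map_apply_of_aemeasurable hae MeasurableSet.univ, preimage_univ,
      Measure.restrict_apply_univ]
    have hcb : Metric.closedBall (0 : E) (δ / 2) ⊆ e.source :=
      (Metric.closedBall_subset_ball (by linarith)).trans hs
    have hK : IsCompact (e '' Metric.closedBall (0 : E) (δ / 2)) :=
      (isCompact_closedBall _ _).image_of_continuousOn (e.continuousOn.mono hcb)
    refine (measure_mono ?_).trans_lt hK.measure_lt_top
    change e'.target ⊆ _
    rw [htarget]
    exact image_mono Metric.ball_subset_closedBall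
  have hev : ∀ x ∈ V, ∀ᶠ r : ℝ in 𝓝[>] 0,
      ρ (Metric.closedBall x r) ≤ (κ • ν) (Metric.closedBall x r) ∧
        ν (Metric.closedBall x r) ≤ (κ • ρ) (Metric.closedBall x r) := by
    intro x hx
    have hx' : ∀ᶠ r : ℝ in 𝓝[>] 0, Metric.closedBall x r ⊆ V := by
      rw [mem_ball_zero_iff] at hx
      filter_upwards [Ioo_mem_nhdsGT (sub_pos.2 hx)] with r hr
      refine Metric.closedBall_subset_ball' ?_
      rw [dist_zero_right]
      linarith [hr.2]
    filter_upwards [hb x (hsub hx), hx'] with r h1 h2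
    rw [Measure.smul_apply, Measure.smul_apply, smul_eq_mul, smul_eq_mul,
      hρ _ h2 Metric.isClosed_closedBall.measurableSet]
    exact ⟨h1.1.trans (by gcongr), h1.2.trans (by gcongr)⟩
  intro s hsV hm
  rw [← hρ s hsV hm]
  lift κ to NNReal using hκ'
  constructor
  -- The disjoint balls must exhaust `s` up to a null set of the measure being estimated, hence the
  -- family of `ρ` here and that of `ν` for the other inequality.
  · refine (Besicovitch.vitaliFamily ρ).measure_le_of_frequently_le (κ • ν)
      Measure.AbsolutelyContinuous.rfl s fun x hx => ?_
    exact (Besicovitch.tendsto_filterAt ρ x).frequently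
      ((hev x (hsV hx)).mono fun r hr => hr.1).frequently
  · refine (Besicovitch.vitaliFamily ν).measure_le_of_frequently_le (κ • ρ)
      Measure.AbsolutelyContinuous.rfl s fun x hx => ?_
    exact (Besicovitch.tendsto_filterAt ν x).frequently
      ((hev x (hsV hx)).mono fun r hr => hr.2).frequently

end measure

end IsExpChart

end LieExp

/-! ### Linearity of homomorphisms in exponential coordinates -/

namespace LieExp

/-- A map defined near `0` that is additive and commutes with integer multiples near `0`, and is
continuous at `0`, agrees near `0` with a continuous linear map. -/
theorem exists_continuousLinearMap_of_local_add {E F : Type*} [NormedAddCommGroup E]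
    [NormedSpace ℝ E] [NormedAddCommGroup F] [NormedSpace ℝ F] {a : E → F} {r : ℝ} (hr : 0 < r)
    (hc : ContinuousAt a 0) (hn : ∀ (k : ℕ) (u : E), ‖k • u‖ < r → a (k • u) = k • a u)
    (ha : ∀ u v : E, ‖u‖ < r → ‖v‖ < r → ‖u + v‖ < r → a (u + v) = a u + a v) :
    ∃ ℓ : E →L[ℝ] F, ∀ v, ‖v‖ < r → a v = ℓ v := by
  have hNex : ∀ v : E, ∃ n : ℕ, 0 < n ∧ ‖v‖ < n * r := by
    intro v
    obtain ⟨n, hn⟩ := exists_nat_gt (‖v‖ / r)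
    refine ⟨n, ?_, (div_lt_iff₀ hr).1 hn⟩
    have : (0 : ℝ) < n := (div_nonneg (norm_nonneg v) hr.le).trans_lt hn
    exact_mod_cast this
  have hsmall : ∀ (v : E) (n : ℕ), 0 < n → ‖v‖ < n * r → ‖(n : ℝ)⁻¹ • v‖ < r := by
    intro v n hn hv
    have : (0 : ℝ) < n := by exact_mod_cast hn
    rw [norm_smul, norm_inv, Real.norm_of_nonneg this.le, inv_mul_lt_iff₀ this]
    exact hv
  choose N hN0 hN using hNex
  -- The extension is `v ↦ n • a (v / n)` for any `n` making `v / n` small; independence of `n`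
  -- follows by comparing `n` and `m` with `n * m`.
  have key : ∀ (v : E) (n m : ℕ), 0 < n → 0 < m → ‖v‖ < n * r →
      n • a ((n : ℝ)⁻¹ • v) = (n * m) • a (((n * m : ℕ) : ℝ)⁻¹ • v) := by
    intro v n m hn0 hm0 hv
    have hm : (m : ℝ) ≠ 0 := by exact_mod_cast hm0.ne'
    have h1 : (n : ℝ)⁻¹ • v = m • (((n * m : ℕ) : ℝ)⁻¹ • v) := by
      rw [← Nat.cast_smul_eq_nsmul ℝ, smul_smul]
      congr 1
      push_cast
      field_simp
    have h2 := hsmall v n hn0 hv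
    rw [h1] at h2 ⊢
    rw [hn m _ h2, smul_smul]
  have hℓ : ∀ (v : E) (n : ℕ), 0 < n → ‖v‖ < n * r →
      N v • a ((N v : ℝ)⁻¹ • v) = n • a ((n : ℝ)⁻¹ • v) := by
    intro v n hn0 hv
    rw [key v n (N v) hn0 (hN0 v) hv, key v (N v) n (hN0 v) hn0 (hN v), mul_comm n]
  let ℓ : E →+ F := AddMonoidHom.mk' (fun v => N v • a ((N v : ℝ)⁻¹ • v)) (by
    intro u v
    obtain ⟨n, hn⟩ := exists_nat_gt ((‖u‖ + ‖v‖) / r)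
    have hn' := (div_lt_iff₀ hr).1 hn
    have hn0 : 0 < n := by
      have : (0 : ℝ) < n := (by positivity : 0 ≤ (‖u‖ + ‖v‖) / r).trans_lt hn
      exact_mod_cast this
    have hu : ‖u‖ < n * r := by linarith [norm_nonneg v]
    have hv : ‖v‖ < n * r := by linarith [norm_nonneg u]
    have huv : ‖u + v‖ < n * r := (norm_add_le u v).trans_lt hn'
    have h3 := hsmall _ n hn0 huv
    rw [smul_add] at h3
    rw [hℓ u n hn0 hu, hℓ v n hn0 hv, hℓ (u + v) n hn0 huv, ← smul_add, smul_add _ u v,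
      ha _ _ (hsmall u n hn0 hu) (hsmall v n hn0 hv) h3])
  have hℓa : ∀ v, ‖v‖ < r → a v = ℓ v := by
    intro v hv
    have h1 := hℓ v 1 one_pos (by simpa using hv)
    simp only [Nat.cast_one, inv_one, one_smul] at h1
    exact h1.symm
  have hcont : Continuous ℓ := by
    refine continuous_of_continuousAt_zero ℓ (hc.congr ?_)
    filter_upwards [Metric.ball_mem_nhds (0 : E) hr] with v hv
    exact hℓa v (mem_ball_zero_iff.1 hv)
  exact ⟨ℓ.toRealLinearMap hcont, fun v hv => hℓa v hv⟩

namespace IsExpChart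

variable {E G : Type*} [NormedAddCommGroup E] [NormedSpace ℝ E] [TopologicalSpace G] [Group G]
  {e : OpenPartialHomeomorph E G}
  {F H : Type*} [NormedAddCommGroup F] [NormedSpace ℝ F] [TopologicalSpace H] [Group H]
  {e' : OpenPartialHomeomorph F H}

/-- The product formula, to first order. -/
theorem tendsto_nsmul_log_mul (he : IsExpChart e) (u v : E) :
    Tendsto (fun n : ℕ => n • e.symm (e ((n : ℝ)⁻¹ • u) * e ((n : ℝ)⁻¹ • v))) atTop
      (𝓝 (u + v)) := by
  have h := he.strict.hasFDerivAt.lim (u, v) (c := fun n : ℕ => (n : ℝ)) (l := atTop)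
    (by simpa using tendsto_natCast_atTop_atTop (R := ℝ))
  simpa [he.map_zero, he.symm_one, Nat.cast_smul_eq_nsmul] using h

/-- Continuous homomorphisms are linear in exponential coordinates. -/
theorem exists_continuousLinearMap [ContinuousMul G] (he : IsExpChart e) (he' : IsExpChart e')
    (σ : G →* H) (hσ : Continuous σ) : ∃ ℓ : E →L[ℝ] F, ∀ᶠ v in 𝓝 0, σ (e v) = e' (ℓ v) := by
  obtain ⟨s, hs, hsF⟩ := Metric.mem_nhds_iff.1 (e'.open_source.mem_nhds he'.zero_mem)
  set a : E → F := fun v => e'.symm (σ (e v)) with ha_def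
  have hσe : ContinuousAt (fun v => σ (e v)) 0 := hσ.continuousAt.comp he.continuousAt_zero
  have ha0 : a 0 = 0 := by simp [ha_def, he.map_zero, he'.symm_one]
  have htarget : ∀ᶠ v in 𝓝 (0 : E), σ (e v) ∈ e'.target :=
    hσe.eventually (e'.open_target.mem_nhds (by simp [he.map_zero, he'.one_mem]))
  have hac0 : ContinuousAt a 0 :=
    (e'.continuousAt_symm (by simp [he.map_zero, he'.one_mem])).comp hσe
  have hsmall : ∀ᶠ v in 𝓝 (0 : E), ‖a v‖ < s / 2 := by
    refine hac0.norm.eventually_lt_const ?_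
    simpa [ha0] using hs
  obtain ⟨r, hr, hball⟩ := Metric.eventually_nhds_iff_ball.1
    ((htarget.and hsmall).and (e.open_source.mem_nhds he.zero_mem))
  have hB : ∀ v : E, ‖v‖ < r → e' (a v) = σ (e v) ∧ ‖a v‖ < s / 2 ∧ ContinuousAt a v := by
    intro v hv
    obtain ⟨⟨h1, h2⟩, h3⟩ := hball v (mem_ball_zero_iff.2 hv)
    exact ⟨e'.right_inv h1, h2,
      (e'.continuousAt_symm h1).comp (f := fun v => σ (e v))
        (hσ.continuousAt.comp (e.continuousAt h3))⟩
  -- Powers give `σ (e (k • u)) = e' (k • a u)`, but `e'` is injective only near `0`. By induction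
  -- `(k + 1) • a u` is a sum of two values of `a` of norm below `s / 2`, so it stays in the source.
  have hn : ∀ (k : ℕ) (u : E), ‖k • u‖ < r → a (k • u) = k • a u := by
    intro k u
    induction k with
    | zero => simp [ha0]
    | succ k ih =>
      intro hk
      have hle : ∀ m : ℕ, m ≤ k + 1 → ‖m • u‖ < r := by
        intro m hm
        refine lt_of_le_of_lt ?_ hk
        rw [← Nat.cast_smul_eq_nsmul ℝ, ← Nat.cast_smul_eq_nsmul ℝ, norm_smul, norm_smul]
        refine mul_le_mul_of_nonneg_right ?_ (norm_nonneg u)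
        simpa using (by exact_mod_cast hm : (m : ℝ) ≤ k + 1).trans (le_abs_self _)
      have hk1 := hle k (by omega)
      have h1 := hle 1 (by omega)
      rw [one_smul] at h1
      have h2 : σ (e ((k + 1) • u)) = e' ((k + 1) • a u) := by
        rw [he.map_nsmul, map_pow, he'.map_nsmul, (hB u h1).1]
      have h3 : (k + 1) • a u ∈ e'.source := by
        apply hsF
        rw [mem_ball_zero_iff, succ_nsmul, ← ih hk1]
        calc _ ≤ ‖a (k • u)‖ + ‖a u‖ := norm_add_le _ _
          _ < s / 2 + s / 2 := add_lt_add (hB _ hk1).2.1 (hB u h1).2.1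
          _ = s := add_halves s
      rw [ha_def]
      simp only
      rw [h2, e'.left_inv h3]
  have hinv : ∀ (n : ℕ), 0 < n → ∀ u : E, ‖u‖ < r →
      ‖(n : ℝ)⁻¹ • u‖ < r ∧ a ((n : ℝ)⁻¹ • u) = (n : ℝ)⁻¹ • a u := by
    intro n hn0 u hu
    have hn0' : (1 : ℝ) ≤ n := by exact_mod_cast hn0
    have hne : (n : ℝ) ≠ 0 := by positivity
    have h1 : n • ((n : ℝ)⁻¹ • u) = u := by
      rw [← Nat.cast_smul_eq_nsmul ℝ, smul_smul, mul_inv_cancel₀ hne, one_smul]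
    refine ⟨?_, ?_⟩
    · rw [norm_smul, norm_inv, Real.norm_of_nonneg (by positivity)]
      exact (mul_le_of_le_one_left (norm_nonneg u) (inv_le_one_of_one_le₀ hn0')).trans_lt hu
    · have h2 := hn n ((n : ℝ)⁻¹ • u) (by rwa [h1])
      rw [h1] at h2
      rw [h2, ← Nat.cast_smul_eq_nsmul ℝ, smul_smul, inv_mul_cancel₀ hne, one_smul]
  have hadd : ∀ u v : E, ‖u‖ < r → ‖v‖ < r → ‖u + v‖ < r → a (u + v) = a u + a v := by
    intro u v hu hv huv
    have h1 := he.tendsto_nsmul_log_mul u v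
    have h2 : Tendsto (fun n : ℕ => a (n • e.symm (e ((n : ℝ)⁻¹ • u) * e ((n : ℝ)⁻¹ • v)))) atTop
        (𝓝 (a (u + v))) := (hB _ huv).2.2.tendsto.comp h1
    have h3 := he'.tendsto_nsmul_log_mul (a u) (a v)
    -- The two product-formula sequences agree eventually: `a` commutes with multiplication by `n`
    -- and by `1 / n`, and `σ` is multiplicative.
    refine tendsto_nhds_unique h2 (h3.congr' ?_)
    have hz : Tendsto (fun n : ℕ => ((n : ℝ)⁻¹ • u, (n : ℝ)⁻¹ • v)) atTop (𝓝 (0 : E × E)) := by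
      have h0 : Tendsto (fun n : ℕ => (n : ℝ)⁻¹) atTop (𝓝 0) := tendsto_inv_atTop_nhds_zero_nat
      have := (h0.smul_const u).prodMk_nhds (h0.smul_const v)
      rwa [zero_smul, zero_smul] at this
    filter_upwards [h1.norm.eventually_lt_const huv, hz.eventually he.eventually_mul_mem_target,
      eventually_gt_atTop 0] with n h4 h5 h6
    rw [hn n _ h4]
    obtain ⟨h7, h8⟩ := hinv n h6 u hu
    obtain ⟨h9, h10⟩ := hinv n h6 v hv
    rw [← h8, ← h10, (hB _ h7).1, (hB _ h9).1, ← map_mul, ha_def]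
    simp only [e.right_inv h5]
  obtain ⟨ℓ, hℓ⟩ := exists_continuousLinearMap_of_local_add hr hac0 hn hadd
  refine ⟨ℓ, ?_⟩
  filter_upwards [Metric.ball_mem_nhds (0 : E) hr] with v hv
  rw [mem_ball_zero_iff] at hv
  rw [← hℓ v hv, (hB v hv).1]

end IsExpChart

end LieExp

/-! ### Dependence of flows on the velocity parameter -/

namespace LieExp

theorem eq_of_hasDerivWithinAt_zero {E : Type*} [NormedAddCommGroup E] [NormedSpace ℝ E]
    {f : ℝ → E} {s : Set ℝ} (hs : Convex ℝ s) (hf : ∀ t ∈ s, HasDerivWithinAt f 0 s t) {a b : ℝ}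
    (ha : a ∈ s) (hb : b ∈ s) : f b = f a := by
  have h := hs.norm_image_sub_le_of_norm_hasDerivWithin_le hf (C := 0) (by simp) ha hb
  rw [zero_mul] at h
  exact sub_eq_zero.1 (norm_le_zero_iff.1 h)

/-- The solutions of `x' = A x v` starting at a point where `A` is the identity depend Lipschitz
continuously on `v`. -/
theorem exists_lipschitz_flow {E : Type*} [NormedAddCommGroup E] [NormedSpace ℝ E]
    [CompleteSpace E] {A : E → E →L[ℝ] E} {c : E} (hA : ContDiffAt ℝ 1 A c) :
    ∃ ε > 0, ∃ r > 0, ∃ L : ℝ, 0 ≤ L ∧ ∃ α : E → ℝ → E,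
      (∀ v, ‖v‖ ≤ r → α v 0 = c ∧ ∀ t ∈ Icc (-ε) ε, ‖α v t - c‖ ≤ L * ‖v‖ ∧
        HasDerivWithinAt (α v) (A (α v t) v) (Icc (-ε) ε) t) ∧
      ∀ u v, ‖u‖ ≤ r → ‖v‖ ≤ r → ∀ t ∈ Icc (-ε) ε, ‖α u t - α v t‖ ≤ L * ‖u - v‖ := by
  -- The parameter `v` becomes a frozen state coordinate, so that Lipschitz dependence on initial
  -- values yields dependence on `v`.
  let f : E × E → E × E := fun p => (A p.1 p.2, 0)
  have hf : ContDiffAt ℝ 1 f (c, 0) := by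
    refine ContDiffAt.prodMk ?_ contDiffAt_const
    exact (hA.comp (c, (0 : E)) contDiffAt_fst).clm_apply contDiffAt_snd
  obtain ⟨ε, hε, a, r, L, K, hr, hpl⟩ := IsPicardLindelof.of_contDiffAt_one hf
  obtain ⟨α, hα, L', hL'⟩ :=
    (hpl 0).exists_forall_mem_closedBall_eq_hasDerivWithinAt_lipschitzOnWith
  simp only [zero_sub, zero_add] at hα hL'
  have h0 : (0 : ℝ) ∈ Icc (-ε) ε := ⟨by linarith, hε.le⟩
  have hmem : ∀ v : E, ‖v‖ ≤ r → (c, v) ∈ Metric.closedBall (c, (0 : E)) (r : ℝ) := by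
    intro v hv
    rw [mem_closedBall_iff_norm, Prod.mk_sub_mk, sub_self, sub_zero, Prod.norm_mk, norm_zero,
      max_eq_right (norm_nonneg _)]
    exact hv
  have h2 : ∀ v : E, ‖v‖ ≤ r → ∀ t ∈ Icc (-ε) ε, (α (c, v) t).2 = v := by
    intro v hv t ht
    obtain ⟨h3, h4⟩ := hα _ (hmem v hv)
    have h5 := eq_of_hasDerivWithinAt_zero (f := fun t => (α (c, v) t).2) (convex_Icc _ _)
      (fun t ht => (h4 t ht).snd) h0 ht
    rw [h5, h3]
  have hderiv : ∀ v : E, ‖v‖ ≤ r → ∀ t ∈ Icc (-ε) ε,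
      HasDerivWithinAt (fun t => (α (c, v) t).1) (A (α (c, v) t).1 v) (Icc (-ε) ε) t := by
    intro v hv t ht
    have h3 := ((hα _ (hmem v hv)).2 t ht).fst
    simp only [f] at h3
    rwa [h2 v hv t ht] at h3
  have hinit : ∀ v : E, ‖v‖ ≤ r → (α (c, v) 0).1 = c := fun v hv => by rw [(hα _ (hmem v hv)).1]
  have hr0 : ‖(0 : E)‖ ≤ r := by simp
  have hzero : ∀ t ∈ Icc (-ε) ε, (α (c, (0 : E)) t).1 = c := by
    intro t ht
    refine (eq_of_hasDerivWithinAt_zero (f := fun t => (α (c, (0 : E)) t).1) (convex_Icc _ _)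
      (fun t ht => ?_) h0 ht).trans (hinit 0 hr0)
    simpa using hderiv 0 hr0 t ht
  have hlip : ∀ u v : E, ‖u‖ ≤ r → ‖v‖ ≤ r → ∀ t ∈ Icc (-ε) ε,
      ‖(α (c, u) t).1 - (α (c, v) t).1‖ ≤ L' * ‖u - v‖ := by
    intro u v hu hv t ht
    have h3 := (hL' t ht).norm_sub_le (hmem u hu) (hmem v hv)
    have h4 : ‖(c, u) - (c, v)‖ = ‖u - v‖ := by
      rw [Prod.mk_sub_mk, sub_self, Prod.norm_mk, norm_zero, max_eq_right (norm_nonneg _)]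
    rw [h4] at h3
    exact (norm_fst_le _).trans h3
  refine ⟨ε, hε, r, hr, L', L'.2, fun v t => (α (c, v) t).1, fun v hv => ⟨hinit v hv, fun t ht =>
    ⟨?_, hderiv v hv t ht⟩⟩, hlip⟩
  -- The solution for `v = 0` is constant, so the Lipschitz estimate against it bounds the
  -- displacement from `c`.
  have h3 := hlip v 0 hv hr0 t ht
  rwa [hzero t ht, sub_zero] at h3

/-- The solutions of `x' = A x v` starting at a point where `A` is the identity are strictly
differentiable with respect to `v` at `0`. -/
theorem exists_strict_flow {E : Type*} [NormedAddCommGroup E] [NormedSpace ℝ E]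
    [CompleteSpace E] {A : E → E →L[ℝ] E} {c : E} (hA : ContDiffAt ℝ 1 A c)
    (hAc : A c = ContinuousLinearMap.id ℝ E) {O : Set E} (hO : O ∈ 𝓝 c) :
    ∃ ε > 0, ∃ α : E → ℝ → E,
      (∀ᶠ v in 𝓝 0, α v 0 = c ∧ ∀ t ∈ Ioo (-ε) ε, α v t ∈ O ∧ HasDerivAt (α v) (A (α v t) v) t) ∧
      ∀ T ∈ Ioo 0 ε, HasStrictFDerivAt (fun v => α v T) (T • ContinuousLinearMap.id ℝ E) 0 := by
  obtain ⟨ε, hε, r, hr, L, hL, α, hα, hlip⟩ := exists_lipschitz_flow hA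
  have hsmall : ∀ ρ > 0, ∀ᶠ v in 𝓝 (0 : E), ‖v‖ ≤ r ∧ L * ‖v‖ < ρ := by
    intro ρ hρ
    have h1 : ContinuousAt (fun v : E => ‖v‖) 0 := continuous_norm.continuousAt
    have h2 : ContinuousAt (fun v : E => L * ‖v‖) 0 := h1.const_mul L
    exact (h1.eventually_le_const (by simpa using hr)).and
      (h2.eventually_lt_const (by simpa using hρ))
  refine ⟨ε, hε, α, ?_, ?_⟩
  · obtain ⟨ρ, hρ, hρO⟩ := Metric.mem_nhds_iff.1 hO
    filter_upwards [hsmall ρ hρ] with v hv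
    refine ⟨(hα v hv.1).1, fun t ht => ?_⟩
    obtain ⟨h1, h2⟩ := (hα v hv.1).2 t (Ioo_subset_Icc_self ht)
    exact ⟨hρO (mem_ball_iff_norm.2 (h1.trans_lt hv.2)), h2.hasDerivAt (Icc_mem_nhds ht.1 ht.2)⟩
  · intro T hT
    refine .of_isLittleO (Asymptotics.isLittleO_iff.2 fun η hη => ?_)
    obtain ⟨K, s, hs, hK⟩ := hA.exists_lipschitzOnWith
    -- Two error terms, each at most `η' * ‖u - v‖`, are integrated over a time `T`.
    set η' : ℝ := η / (2 * T) with hη'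
    have hη'0 : 0 < η' := div_pos hη (by linarith [hT.1])
    have hAη : ∀ᶠ x in 𝓝 c, ‖A x - ContinuousLinearMap.id ℝ E‖ < η' := by
      have h1 : ContinuousAt (fun x => ‖A x - ContinuousLinearMap.id ℝ E‖) c :=
        (hA.continuousAt.sub continuousAt_const).norm
      exact h1.eventually_lt_const (by simpa [hAc] using hη'0)
    obtain ⟨ρ, hρ, hρs⟩ := Metric.mem_nhds_iff.1 (inter_mem hs hAη)
    have hKL : ∀ᶠ v in 𝓝 (0 : E), K * L * ‖v‖ < η' := by
      have h1 : ContinuousAt (fun v : E => K * L * ‖v‖) 0 :=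
        continuous_norm.continuousAt.const_mul _
      exact h1.eventually_lt_const (by simpa using hη'0)
    rw [nhds_prod_eq]
    have hev := (hsmall ρ hρ).and hKL
    filter_upwards [hev.prod_mk hev] with ⟨u, v⟩ ⟨⟨hu, hu'⟩, ⟨hv, hv'⟩⟩
    simp only at hu hu' hv hv' ⊢
    have hsub : Icc 0 T ⊆ Icc (-ε) ε := Icc_subset_Icc (by linarith) hT.2.le
    have hball : ∀ w, (‖w‖ ≤ r ∧ L * ‖w‖ < ρ) → ∀ t ∈ Icc 0 T, α w t ∈ Metric.ball c ρ :=
      fun w hw t ht => mem_ball_iff_norm.2 (((hα w hw.1).2 t (hsub ht)).1.trans_lt hw.2)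
    have hd : ∀ t ∈ Icc 0 T, HasDerivWithinAt (fun t => α u t - α v t - t • (u - v))
        (A (α u t) u - A (α v t) v - (1 : ℝ) • (u - v)) (Icc 0 T) t := by
      intro t ht
      have h1 := ((hα u hu.1).2 t (hsub ht)).2.mono hsub
      have h2 := ((hα v hv.1).2 t (hsub ht)).2.mono hsub
      exact (h1.sub h2).sub ((hasDerivWithinAt_id t _).smul_const (u - v))
    have hb : ∀ t ∈ Icc 0 T,
        ‖A (α u t) u - A (α v t) v - (1 : ℝ) • (u - v)‖ ≤ 2 * η' * ‖u - v‖ := by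
      intro t ht
      have hmu := hρs (hball u hu t ht)
      have hmv := hρs (hball v hv t ht)
      -- The first term is small because `A` is near the identity; the second because `A` varies by
      -- at most `K * L * ‖u - v‖` and is applied to the small vector `v`.
      have h1 : A (α u t) u - A (α v t) v - (1 : ℝ) • (u - v) =
          (A (α u t) - ContinuousLinearMap.id ℝ E) (u - v) + (A (α u t) - A (α v t)) v := by
        simp only [map_sub, sub_apply, ContinuousLinearMap.id_apply, one_smul]
        abel
      rw [h1]
      have h2 : ‖A (α u t) - A (α v t)‖ ≤ K * (L * ‖u - v‖) :=
        (hK.norm_sub_le hmu.1 hmv.1).trans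
          (mul_le_mul_of_nonneg_left (hlip u v hu.1 hv.1 t (hsub ht)) K.2)
      calc _ ≤ ‖A (α u t) - ContinuousLinearMap.id ℝ E‖ * ‖u - v‖ +
            ‖A (α u t) - A (α v t)‖ * ‖v‖ :=
            (norm_add_le _ _).trans (add_le_add (ContinuousLinearMap.le_opNorm _ _)
              (ContinuousLinearMap.le_opNorm _ _))
        _ ≤ η' * ‖u - v‖ + K * (L * ‖u - v‖) * ‖v‖ := by
            gcongr
            exact le_of_lt hmu.2
        _ = η' * ‖u - v‖ + (K * L * ‖v‖) * ‖u - v‖ := by ring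
        _ ≤ η' * ‖u - v‖ + η' * ‖u - v‖ := by gcongr
        _ = 2 * η' * ‖u - v‖ := by ring
    have h := (convex_Icc 0 T).norm_image_sub_le_of_norm_hasDerivWithin_le hd hb
      (left_mem_Icc.2 hT.1.le) (right_mem_Icc.2 hT.1.le)
    rw [(hα u hu.1).1, (hα v hv.1).1] at h
    simp only [sub_self, zero_smul, sub_zero] at h
    calc _ = ‖α u T - α v T - T • (u - v)‖ := by simp
      _ ≤ 2 * η' * ‖u - v‖ * ‖T‖ := h
      _ = η * ‖u - v‖ := by
          rw [Real.norm_of_nonneg hT.1.le, hη']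
          field_simp [hT.1.ne']

end LieExp

/-! ### The group law and left-invariant fields in a chart -/

namespace LieExp

section chartMul

variable {E : Type*} [NormedAddCommGroup E]
  {G : Type*} [TopologicalSpace G] [ChartedSpace E G] [Group G]

variable (E G) in
/-- The multiplication of a Lie group, read in the preferred chart at the identity. -/
noncomputable def chartMul (x y : E) : E :=
  chartAt E (1 : G) ((chartAt E (1 : G)).symm x * (chartAt E (1 : G)).symm y)

variable (E G) in
/-- The coordinates of the identity in the preferred chart. -/
noncomputable def chartOne : E := chartAt E (1 : G) 1

theorem chartOne_mem : chartOne E G ∈ (chartAt E (1 : G)).target := mem_chart_target E 1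

theorem chartAt_symm_chartOne : (chartAt E (1 : G)).symm (chartOne E G) = 1 :=
  (chartAt E (1 : G)).left_inv (mem_chart_source E 1)

theorem chartMul_chartOne_left {y : E} (hy : y ∈ (chartAt E (1 : G)).target) :
    chartMul E G (chartOne E G) y = y := by
  rw [chartMul, chartAt_symm_chartOne, one_mul, (chartAt E (1 : G)).right_inv hy]

theorem chartMul_chartOne_right {y : E} (hy : y ∈ (chartAt E (1 : G)).target) :
    chartMul E G y (chartOne E G) = y := by
  rw [chartMul, chartAt_symm_chartOne, mul_one, (chartAt E (1 : G)).right_inv hy]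

end chartMul

variable {E : Type*} [NormedAddCommGroup E] [NormedSpace ℝ E]
  {G : Type*} [TopologicalSpace G] [ChartedSpace E G]

/-- The tangent space at `g` is identified with `E` through the preferred chart at `g`, so this
chart and its inverse have identity derivative there. -/
theorem hasMFDerivAt_chartAt_symm (g : G) :
    HasMFDerivAt 𝓘(ℝ, E) 𝓘(ℝ, E) (chartAt E g).symm (chartAt E g g)
      (ContinuousLinearMap.id ℝ E) := by
  refine ⟨(chartAt E g).continuousAt_symm (mem_chart_target E g), ?_⟩
  have h : HasFDerivAt ((chartAt E g) ∘ (chartAt E g).symm) (ContinuousLinearMap.id ℝ E)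
      (chartAt E g g) := by
    refine (hasFDerivAt_id _).congr_of_eventuallyEq ?_
    filter_upwards [(chartAt E g).open_target.mem_nhds (mem_chart_target E g)] with x hx
    exact (chartAt E g).right_inv hx
  have h' := h.hasFDerivWithinAt (s := univ)
  simp only [writtenInExtChartAt, extChartAt, chartAt_self_eq, mfld_simps]
  exact h'

theorem hasMFDerivAt_chartAt (g : G) :
    HasMFDerivAt 𝓘(ℝ, E) 𝓘(ℝ, E) (chartAt E g) g (ContinuousLinearMap.id ℝ E) := by
  refine ⟨(chartAt E g).continuousAt (mem_chart_source E g), ?_⟩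
  have h : HasFDerivAt ((chartAt E g) ∘ (chartAt E g).symm) (ContinuousLinearMap.id ℝ E)
      (chartAt E g g) := by
    refine (hasFDerivAt_id _).congr_of_eventuallyEq ?_
    filter_upwards [(chartAt E g).open_target.mem_nhds (mem_chart_target E g)] with x hx
    exact (chartAt E g).right_inv hx
  have h' := h.hasFDerivWithinAt (s := univ)
  simp only [writtenInExtChartAt, extChartAt, chartAt_self_eq, mfld_simps]
  exact h'

variable [Group G]

variable (E G) in
/-- The differentials of the left translations at the identity, read in the chart. -/
noncomputable def chartField (x : E) : E →L[ℝ] E :=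
  fderiv ℝ (chartMul E G x) (chartOne E G)

theorem chartField_chartOne : chartField E G (chartOne E G) = ContinuousLinearMap.id ℝ E := by
  refine HasFDerivAt.fderiv ((hasFDerivAt_id _).congr_of_eventuallyEq ?_)
  filter_upwards [(chartAt E (1 : G)).open_target.mem_nhds (chartOne_mem (E := E) (G := G))]
    with x hx
  exact chartMul_chartOne_left hx

variable [LieGroup 𝓘(ℝ, E) ∞ G]

theorem contDiffAt_chartMul {x y : E} (hx : x ∈ (chartAt E (1 : G)).target)
    (hy : y ∈ (chartAt E (1 : G)).target)
    (hxy : (chartAt E (1 : G)).symm x * (chartAt E (1 : G)).symm y ∈ (chartAt E (1 : G)).source) :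
    ContDiffAt ℝ ∞ (Function.uncurry (chartMul E G)) (x, y) := by
  have hs : ∀ z ∈ (chartAt E (1 : G)).target,
      ContMDiffAt 𝓘(ℝ, E) 𝓘(ℝ, E) ∞ (chartAt E (1 : G)).symm z := fun z hz =>
    (contMDiffOn_chart_symm (I := 𝓘(ℝ, E)) (x := (1 : G))).contMDiffAt
      ((chartAt E (1 : G)).open_target.mem_nhds hz)
  have hc : ContMDiffAt 𝓘(ℝ, E) 𝓘(ℝ, E) ∞ (chartAt E (1 : G))
      ((chartAt E (1 : G)).symm x * (chartAt E (1 : G)).symm y) :=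
    (contMDiffOn_chart (I := 𝓘(ℝ, E)) (x := (1 : G))).contMDiffAt
      ((chartAt E (1 : G)).open_source.mem_nhds hxy)
  have h1 : ContMDiffAt 𝓘(ℝ, E × E) 𝓘(ℝ, E) ∞
      (fun p : E × E => (chartAt E (1 : G)).symm p.1) (x, y) :=
    (hs x hx).comp (x, y) contDiff_fst.contMDiff.contMDiffAt
  have h2 : ContMDiffAt 𝓘(ℝ, E × E) 𝓘(ℝ, E) ∞
      (fun p : E × E => (chartAt E (1 : G)).symm p.2) (x, y) :=
    (hs y hy).comp (x, y) contDiff_snd.contMDiff.contMDiffAt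
  exact (hc.comp (x, y) (h1.mul h2)).contDiffAt

theorem contDiffAt_chartMul_one_right {x : E} (hx : x ∈ (chartAt E (1 : G)).target) :
    ContDiffAt ℝ ∞ (Function.uncurry (chartMul E G)) (x, chartOne E G) := by
  refine contDiffAt_chartMul hx chartOne_mem ?_
  rw [chartAt_symm_chartOne, mul_one]
  exact (chartAt E (1 : G)).map_target hx

/-- The multiplication is strictly differentiable at the identity, with derivative the addition. -/
theorem hasStrictFDerivAt_chartMul :
    HasStrictFDerivAt (Function.uncurry (chartMul E G))
      (ContinuousLinearMap.fst ℝ E E + ContinuousLinearMap.snd ℝ E E)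
      (chartOne E G, chartOne E G) := by
  have h := (contDiffAt_chartMul_one_right (chartOne_mem (E := E) (G := G))).hasStrictFDerivAt
    (by simp)
  have hnhds := (chartAt E (1 : G)).open_target.mem_nhds (chartOne_mem (E := E) (G := G))
  -- Neutrality of the identity on either side makes both partial derivatives the identity.
  have h1 : HasFDerivAt (fun x => Function.uncurry (chartMul E G) (x, chartOne E G))
      (ContinuousLinearMap.id ℝ E) (chartOne E G) := by
    refine (hasFDerivAt_id _).congr_of_eventuallyEq ?_
    filter_upwards [hnhds] with x hx
    exact chartMul_chartOne_right hx
  have h2 : HasFDerivAt (fun x => Function.uncurry (chartMul E G) (chartOne E G, x))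
      (ContinuousLinearMap.id ℝ E) (chartOne E G) := by
    refine (hasFDerivAt_id _).congr_of_eventuallyEq ?_
    filter_upwards [hnhds] with x hx
    exact chartMul_chartOne_left hx
  have h3 := h.hasFDerivAt.comp (f := fun x => (x, chartOne E G)) (chartOne E G)
    (hasFDerivAt_prodMk_left (𝕜 := ℝ) (chartOne E G) (chartOne E G))
  have h4 := h.hasFDerivAt.comp (f := fun x => (chartOne E G, x)) (chartOne E G)
    (hasFDerivAt_prodMk_right (𝕜 := ℝ) (chartOne E G) (chartOne E G))
  have h5 := h3.unique h1
  have h6 := h4.unique h2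
  have h7 : fderiv ℝ (Function.uncurry (chartMul E G)) (chartOne E G, chartOne E G) =
      ContinuousLinearMap.fst ℝ E E + ContinuousLinearMap.snd ℝ E E := by
    refine ContinuousLinearMap.ext fun p => ?_
    have h8 := DFunLike.congr_fun h5 p.1
    have h9 := DFunLike.congr_fun h6 p.2
    simp only [ContinuousLinearMap.comp_apply, ContinuousLinearMap.inl_apply,
      ContinuousLinearMap.inr_apply, ContinuousLinearMap.id_apply] at h8 h9
    have h10 : p = (p.1, 0) + (0, p.2) := by simp
    rw [h10, map_add, h8, h9]
    simp
  rwa [h7] at h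

theorem hasFDerivAt_chartMul {x : E} (hx : x ∈ (chartAt E (1 : G)).target) :
    HasFDerivAt (chartMul E G x) (chartField E G x) (chartOne E G) := by
  have h : ContDiffAt ℝ ∞ (chartMul E G x) (chartOne E G) :=
    (contDiffAt_chartMul_one_right hx).comp (chartOne E G)
      (contDiffAt_const.prodMk contDiffAt_id)
  exact (h.differentiableAt (by simp)).hasFDerivAt

theorem contDiffAt_chartField : ContDiffAt ℝ 1 (chartField E G) (chartOne E G) :=
  (contDiffAt_chartMul_one_right (chartOne_mem (E := E) (G := G))).fderiv
    (g := fun _ => chartOne E G) contDiffAt_const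
    (by rw [one_add_one_eq_two]; exact ENat.LEInfty.out)

/-- The differential of a left translation at the identity. -/
noncomputable def leftDeriv (g : G) : E →L[ℝ] E :=
  mfderiv 𝓘(ℝ, E) 𝓘(ℝ, E) (fun x : G => g * x) 1

theorem hasMFDerivAt_mul_left (g : G) {y : G} (hy : y = 1) :
    HasMFDerivAt 𝓘(ℝ, E) 𝓘(ℝ, E) (fun x : G => g * x) y (leftDeriv (E := E) g) := by
  subst hy
  exact ((contMDiff_mul_left (I := 𝓘(ℝ, E)) (n := ∞) (a := g)).contMDiffAt.mdifferentiableAt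
    (by simp)).hasMFDerivAt

/-- The chain rule at the identity, applied to both sides of `φ.symm (chartMul x y) = φ.symm x *
φ.symm y` for the chart `φ` at `1`. Quantifying over `y = x` avoids rewriting base points inside
tangent spaces. -/
theorem exists_hasMFDerivAt_symm {x : E} (hx : x ∈ (chartAt E (1 : G)).target) :
    ∃ P : E →L[ℝ] E, (∀ y, y = x → HasMFDerivAt 𝓘(ℝ, E) 𝓘(ℝ, E) (chartAt E (1 : G)).symm y P) ∧
      ∀ v, P (chartField E G x v) = leftDeriv (E := E) ((chartAt E (1 : G)).symm x) v := by
  have : IsManifold 𝓘(ℝ, E) 1 G := IsManifold.of_le (n := ∞) (by simp)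
  have hd : MDifferentiableAt 𝓘(ℝ, E) 𝓘(ℝ, E) (chartAt E (1 : G)).symm x :=
    ((contMDiffOn_chart_symm (I := 𝓘(ℝ, E)) (n := 1) (x := (1 : G))).contMDiffAt
      ((chartAt E (1 : G)).open_target.mem_nhds hx)).mdifferentiableAt (by simp)
  let P : E →L[ℝ] E := mfderiv 𝓘(ℝ, E) 𝓘(ℝ, E) (chartAt E (1 : G)).symm x
  have hP : ∀ y, y = x → HasMFDerivAt 𝓘(ℝ, E) 𝓘(ℝ, E) (chartAt E (1 : G)).symm y P := by
    rintro y rfl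
    exact hd.hasMFDerivAt
  refine ⟨P, hP, ?_⟩
  set g := (chartAt E (1 : G)).symm x with hg
  have h1 : HasMFDerivAt 𝓘(ℝ, E) 𝓘(ℝ, E) (fun y => g * (chartAt E (1 : G)).symm y) (chartOne E G)
      ((leftDeriv (E := E) g).comp (ContinuousLinearMap.id ℝ E)) :=
    HasMFDerivAt.comp (chartOne E G) (hasMFDerivAt_mul_left (E := E) g chartAt_symm_chartOne)
      (hasMFDerivAt_chartAt_symm (1 : G))
  have h2 : HasMFDerivAt 𝓘(ℝ, E) 𝓘(ℝ, E)
      (fun y => (chartAt E (1 : G)).symm (chartMul E G x y)) (chartOne E G)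
      (P.comp (chartField E G x)) :=
    HasMFDerivAt.comp (chartOne E G) (hP _ (chartMul_chartOne_right hx))
      (hasFDerivAt_chartMul hx).hasMFDerivAt
  have h3 : (fun y => (chartAt E (1 : G)).symm (chartMul E G x y)) =ᶠ[𝓝 (chartOne E G)]
      (fun y => g * (chartAt E (1 : G)).symm y) := by
    have hc := h1.continuousAt
    have hm : g * (chartAt E (1 : G)).symm (chartOne E G) ∈ (chartAt E (1 : G)).source := by
      rw [chartAt_symm_chartOne, mul_one]
      exact (chartAt E (1 : G)).map_target hx
    filter_upwards [hc.eventually ((chartAt E (1 : G)).open_source.mem_nhds hm)] with y hy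
    exact (chartAt E (1 : G)).left_inv hy
  have h4 := h2.congr_of_eventuallyEq h3.symm
  intro v
  have h5 : P.comp (chartField E G x) = (leftDeriv (E := E) g).comp (ContinuousLinearMap.id ℝ E) :=
    hasMFDerivAt_unique h4 h1
  exact DFunLike.congr_fun h5 v

/-- Solutions of the differential equation in the chart are integral curves of left-invariant vector
fields. -/
theorem hasMFDerivAt_of_hasDerivAt {x : ℝ → E} {t : ℝ} {v : GroupLieAlgebra 𝓘(ℝ, E) G}
    (ht : x t ∈ (chartAt E (1 : G)).target) (hx : HasDerivAt x (chartField E G (x t) v) t) :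
    HasMFDerivAt 𝓘(ℝ, ℝ) 𝓘(ℝ, E) (fun s => (chartAt E (1 : G)).symm (x s)) t
      ((1 : ℝ →L[ℝ] ℝ).smulRight
        (mulInvariantVectorField v ((chartAt E (1 : G)).symm (x t)))) := by
  obtain ⟨P, hP, hP'⟩ := exists_hasMFDerivAt_symm ht
  have h := HasMFDerivAt.comp t (hP _ rfl) hx.hasFDerivAt.hasMFDerivAt
  refine h.congr_mfderiv ?_
  refine ContinuousLinearMap.ext fun b => ?_
  let a : ℝ := b
  have h1 := hP' v
  have h2 : P (a • chartField E G (x t) v) =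
      a • leftDeriv (E := E) ((chartAt E (1 : G)).symm (x t)) v := by
    rw [P.map_smul, h1]
  exact h2

end LieExp

/-! ### The exponential mapping provides exponential coordinates -/

namespace LieExp

/-- The coordinates must equal the exponential mapping everywhere, not only on their source, since
`IsExpChart.add_smul` is a global identity. -/
theorem exists_openPartialHomeomorph_of_eqOn {A B : Type*} [TopologicalSpace A]
    [TopologicalSpace B] (e : OpenPartialHomeomorph A B) {f : A → B} (h : EqOn f e e.source) :
    ∃ e' : OpenPartialHomeomorph A B,
      (e' : A → B) = f ∧ e'.source = e.source ∧ (e'.symm : B → A) = e.symm :=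
  ⟨{ toFun := f
     invFun := e.symm
     source := e.source
     target := e.target
     map_source' := fun x hx => by rw [h hx]; exact e.map_source hx
     map_target' := fun y hy => e.map_target hy
     left_inv' := fun x hx => by rw [h hx]; exact e.left_inv hx
     right_inv' := fun y hy => by rw [h (e.map_target hy)]; exact e.right_inv hy
     open_source := e.open_source
     open_target := e.open_target
     continuousOn_toFun := e.continuousOn.congr h
     continuousOn_invFun := e.continuousOn_symm }, rfl, rfl, rfl⟩

variable {E : Type*} [NormedAddCommGroup E] [NormedSpace ℝ E]
  {G : Type*} [TopologicalSpace G] [ChartedSpace E G] [Group G] [LieGroup 𝓘(ℝ, E) ∞ G]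

/-- Left translates of integral curves of left-invariant vector fields are integral curves. -/
theorem isMIntegralCurve_mul_left {γ : ℝ → G} {v : GroupLieAlgebra 𝓘(ℝ, E) G}
    (hγ : IsMIntegralCurve (I := 𝓘(ℝ, E)) γ (mulInvariantVectorField v)) (g : G) :
    IsMIntegralCurve (I := 𝓘(ℝ, E)) (fun t => g * γ t) (mulInvariantVectorField v) := by
  intro t
  have hL : ∀ a b : G, MDifferentiableAt 𝓘(ℝ, E) 𝓘(ℝ, E) (fun x => a * x) b := fun a b =>
    (contMDiff_mul_left (I := 𝓘(ℝ, E)) (n := ∞) (a := a)).contMDiffAt.mdifferentiableAt (by simp)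
  refine ((hL g (γ t)).hasMFDerivAt.comp t (hγ t)).congr_mfderiv ?_
  have key : ∀ b c : G, b * 1 = c → ∀ w : E,
      (mfderiv 𝓘(ℝ, E) 𝓘(ℝ, E) (fun x => g * x) c : E →L[ℝ] E)
        ((mfderiv 𝓘(ℝ, E) 𝓘(ℝ, E) (fun x => b * x) 1 : E →L[ℝ] E) w) =
      (mfderiv 𝓘(ℝ, E) 𝓘(ℝ, E) (fun x => g * b * x) 1 : E →L[ℝ] E) w := by
    rintro b c rfl w
    have hcomp : (fun x => g * b * x) = (fun x => g * x) ∘ (fun x => b * x) := by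
      ext x; simp [mul_assoc]
    rw [hcomp, mfderiv_comp (I := 𝓘(ℝ, E)) (I' := 𝓘(ℝ, E)) (I'' := 𝓘(ℝ, E)) (1 : G)
      (g := fun x => g * x) (f := fun x => b * x) (hL g _) (hL b 1)]
    rfl
  refine ContinuousLinearMap.ext fun a => ?_
  have hk := key (γ t) (γ t) (mul_one _) v
  have h4 := (mfderiv 𝓘(ℝ, E) 𝓘(ℝ, E) (fun x => g * x) (γ t) : E →L[ℝ] E).map_smul (a : ℝ)
    ((mfderiv 𝓘(ℝ, E) 𝓘(ℝ, E) (fun x => γ t * x) 1 : E →L[ℝ] E) v)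
  rw [hk] at h4
  exact h4

variable [FiniteDimensional ℝ E]

theorem contMDiff_one_mulInvariantVectorField (v : GroupLieAlgebra 𝓘(ℝ, E) G) :
    ContMDiff 𝓘(ℝ, E) 𝓘(ℝ, E).tangent 1
      (fun g : G => (⟨g, mulInvariantVectorField v g⟩ : TangentBundle 𝓘(ℝ, E) G)) := by
  have : CompleteSpace E := FiniteDimensional.complete ℝ E
  have h3 : LieGroup 𝓘(ℝ, E) (minSmoothness ℝ 3) G :=
    LieGroup.of_le (n := ∞) (by
      rw [minSmoothness_of_isRCLikeNormedField]; exact ENat.LEInfty.out)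
  exact (contMDiff_mulInvariantVectorField (I := 𝓘(ℝ, E)) v).of_le
    (show (1 : ℕ∞ω) ≤ minSmoothness ℝ 2 by simp)

variable [T2Space G]

/-- The one-parameter subgroup with a given derivative at `0`. -/
noncomputable def lieCurve (v : GroupLieAlgebra 𝓘(ℝ, E) G) : ℝ → G :=
  (exists_integralCurve v).choose

theorem lieCurve_zero (v : GroupLieAlgebra 𝓘(ℝ, E) G) : lieCurve v 0 = 1 :=
  (exists_integralCurve v).choose_spec.1

theorem isMIntegralCurve_lieCurve (v : GroupLieAlgebra 𝓘(ℝ, E) G) :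
    IsMIntegralCurve (I := 𝓘(ℝ, E)) (lieCurve v) (mulInvariantVectorField v) :=
  (exists_integralCurve v).choose_spec.2

/-- Uniqueness removes the ambiguity of the chosen curves: comparing a curve with its time shifts
and rescalings gives the one-parameter subgroup laws. -/
theorem isMIntegralCurve_eq {γ γ' : ℝ → G} {v : GroupLieAlgebra 𝓘(ℝ, E) G}
    (hγ : IsMIntegralCurve (I := 𝓘(ℝ, E)) γ (mulInvariantVectorField v))
    (hγ' : IsMIntegralCurve (I := 𝓘(ℝ, E)) γ' (mulInvariantVectorField v)) (h : γ 0 = γ' 0) :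
    γ = γ' := by
  have h1 : IsManifold 𝓘(ℝ, E) 1 G := IsManifold.of_le (n := ∞) (by simp)
  exact isMIntegralCurve_Ioo_eq_of_contMDiff_boundaryless (t₀ := 0)
    (contMDiff_one_mulInvariantVectorField v) hγ hγ' h

theorem lieCurve_add (v : GroupLieAlgebra 𝓘(ℝ, E) G) (s t : ℝ) :
    lieCurve v (s + t) = lieCurve v s * lieCurve v t := by
  have h := isMIntegralCurve_eq ((isMIntegralCurve_lieCurve v).comp_add s)
    (isMIntegralCurve_mul_left (isMIntegralCurve_lieCurve v) (lieCurve v s))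
    (by simp [lieCurve_zero])
  have := congrFun h t
  simpa [add_comm] using this

theorem lieExp_smul (v : GroupLieAlgebra 𝓘(ℝ, E) G) (t : ℝ) :
    lieExp (t • v) = lieCurve v t := by
  have h1 := (isMIntegralCurve_lieCurve v).comp_mul t
  rw [← mulInvariantVectorField_smul] at h1
  have h := isMIntegralCurve_eq (isMIntegralCurve_lieCurve (t • v)) h1
    (by simp [lieCurve_zero])
  have h2 : lieCurve (t • v) 1 = lieCurve v (1 * t) := congrFun h 1
  rw [one_mul] at h2
  exact h2

theorem lieExp_add_smul (v : GroupLieAlgebra 𝓘(ℝ, E) G) (s t : ℝ) :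
    lieExp ((s + t) • v) = lieExp (s • v) * lieExp (t • v) := by
  rw [lieExp_smul, lieExp_smul, lieExp_smul, lieCurve_add]

/-- The exponential mapping, as a mapping on the model space. -/
noncomputable def modelExp (G : Type*) [TopologicalSpace G] [ChartedSpace E G] [Group G]
    [LieGroup 𝓘(ℝ, E) ∞ G] [T2Space G] (v : E) : G :=
  lieExp (E := E) (G := G) v

theorem modelExp_add_smul (v : E) (s t : ℝ) :
    modelExp G ((s + t) • v) = modelExp G (s • v) * modelExp G (t • v) :=
  lieExp_add_smul (E := E) (G := G) v s t

theorem modelExp_zero : modelExp G (0 : E) = 1 := by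
  have h := modelExp_add_smul (G := G) (0 : E) 0 0
  simpa using h

/-- The exponential mapping, read in the preferred chart at the identity, is strictly differentiable
at `0`, with derivative the identity. -/
theorem exists_hasStrictFDerivAt_modelExp :
    (∀ᶠ v in 𝓝 (0 : E), modelExp G v ∈ (chartAt E (1 : G)).source) ∧
      HasStrictFDerivAt (fun v : E => chartAt E (1 : G) (modelExp G v))
        (ContinuousLinearMap.id ℝ E) 0 := by
  have : CompleteSpace E := FiniteDimensional.complete ℝ E
  have hman : IsManifold 𝓘(ℝ, E) 1 G := IsManifold.of_le (n := ∞) (by simp)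
  obtain ⟨ε, hε, α, hα, hstrict⟩ := exists_strict_flow (contDiffAt_chartField (E := E) (G := G))
    chartField_chartOne ((chartAt E (1 : G)).open_target.mem_nhds chartOne_mem)
  have hcurve : ∀ᶠ v in 𝓝 (0 : E), ∀ t ∈ Ioo (-ε) ε, α v t ∈ (chartAt E (1 : G)).target ∧
      modelExp G (t • v) = (chartAt E (1 : G)).symm (α v t) := by
    filter_upwards [hα] with v hv t ht
    refine ⟨(hv.2 t ht).1, ?_⟩
    have h1 : IsMIntegralCurveOn (I := 𝓘(ℝ, E)) (fun s => (chartAt E (1 : G)).symm (α v s))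
        (mulInvariantVectorField (I := 𝓘(ℝ, E)) (G := G) v) (Ioo (-ε) ε) := fun s hs =>
      (hasMFDerivAt_of_hasDerivAt (v := v) (hv.2 s hs).1 (hv.2 s hs).2).hasMFDerivWithinAt
    have h2 := isMIntegralCurveOn_Ioo_eqOn_of_contMDiff_boundaryless (t₀ := 0)
      ⟨by linarith, hε⟩ (contMDiff_one_mulInvariantVectorField (G := G) v)
      ((isMIntegralCurve_lieCurve (G := G) v).isMIntegralCurveOn (Ioo (-ε) ε)) h1
      ((lieCurve_zero (G := G) v).trans (by rw [hv.1, chartAt_symm_chartOne]))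
    exact (lieExp_smul (G := G) v t).trans (h2 ht)
  -- The local flow need not reach time `1`, so the exponential of `v` is read off at time `T` from
  -- the velocity `T⁻¹ • v`; the derivative factors `T` and `T⁻¹` cancel.
  set T := ε / 2 with hT
  have hT0 : 0 < T := half_pos hε
  have hTm : T ∈ Ioo (-ε) ε := ⟨by linarith, by linarith⟩
  have htend : Tendsto (fun v : E => T⁻¹ • v) (𝓝 0) (𝓝 0) := by
    have := (continuous_const_smul (T⁻¹) (T := E)).tendsto 0
    simpa using this
  have hev : ∀ᶠ v in 𝓝 (0 : E), α (T⁻¹ • v) T ∈ (chartAt E (1 : G)).target ∧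
      modelExp G v = (chartAt E (1 : G)).symm (α (T⁻¹ • v) T) := by
    filter_upwards [htend.eventually hcurve] with v hv
    have h1 := hv T hTm
    rwa [smul_smul, mul_inv_cancel₀ hT0.ne', one_smul] at h1
  refine ⟨?_, ?_⟩
  · filter_upwards [hev] with v hv
    rw [hv.2]
    exact (chartAt E (1 : G)).map_target hv.1
  · have h1 : HasStrictFDerivAt (fun v : E => T⁻¹ • v) (T⁻¹ • ContinuousLinearMap.id ℝ E) 0 :=
      (hasStrictFDerivAt_id (0 : E)).const_smul T⁻¹
    have h2 : HasStrictFDerivAt (fun v => α v T) (T • ContinuousLinearMap.id ℝ E) (T⁻¹ • 0) := by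
      rw [smul_zero]
      exact hstrict T ⟨hT0, hTm.2⟩
    have h3 := h2.comp (f := fun v : E => T⁻¹ • v) 0 h1
    have h4 : (T • ContinuousLinearMap.id ℝ E).comp (T⁻¹ • ContinuousLinearMap.id ℝ E) =
        ContinuousLinearMap.id ℝ E := by
      ext v
      simp [smul_smul, hT0.ne']
    rw [h4] at h3
    refine h3.congr_of_eventuallyEq ?_
    filter_upwards [hev] with v hv
    rw [hv.2, (chartAt E (1 : G)).right_inv hv.1]

/-- The exponential mapping of a Lie group defines exponential coordinates, which are compatible
with the identification of the Lie algebra with the tangent space at the identity. -/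
theorem exists_isExpChart :
    ∃ e : OpenPartialHomeomorph E G, (e : E → G) = modelExp G ∧ IsExpChart e ∧
      HasMFDerivAt 𝓘(ℝ, E) 𝓘(ℝ, E) e 0 (ContinuousLinearMap.id ℝ E) ∧
      HasMFDerivAt 𝓘(ℝ, E) 𝓘(ℝ, E) e.symm 1 (ContinuousLinearMap.id ℝ E) := by
  have : CompleteSpace E := FiniteDimensional.complete ℝ E
  obtain ⟨hsrc, hf⟩ := exists_hasStrictFDerivAt_modelExp (E := E) (G := G)
  set φ := chartAt E (1 : G) with hφ
  set f : E → E := fun v => φ (modelExp G v) with hfdef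
  have hf0 : f 0 = chartOne E G := by simp only [hfdef, modelExp_zero]; rfl
  have hf' : HasStrictFDerivAt f ((ContinuousLinearEquiv.refl ℝ E : E ≃L[ℝ] E) : E →L[ℝ] E) 0 := hf
  let h : OpenPartialHomeomorph E E := hf'.toOpenPartialHomeomorph f
  have hsymm : HasStrictFDerivAt h.symm (ContinuousLinearMap.id ℝ E) (f 0) := hf'.to_localInverse
  have hh0 : (0 : E) ∈ h.source := hf'.mem_toOpenPartialHomeomorph_source
  have hhf : (h : E → E) = f := hf'.toOpenPartialHomeomorph_coe
  -- Without this restriction `φ.symm (φ (modelExp G v))` could differ from `modelExp G v`.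
  let e0 : OpenPartialHomeomorph E G := (h.trans φ.symm).restr {v | modelExp G v ∈ φ.source}
  have heq : EqOn (modelExp G) e0 e0.source := by
    intro v hv
    rw [OpenPartialHomeomorph.restr_source] at hv
    have h1 : v ∈ {v | modelExp G v ∈ φ.source} := interior_subset hv.2
    exact (φ.left_inv h1).symm
  obtain ⟨e, he, hes, hei⟩ := exists_openPartialHomeomorph_of_eqOn e0 heq
  have hei' : ∀ g, e.symm g = h.symm (φ g) := fun g => by rw [hei]; rfl
  have hzero : (0 : E) ∈ e.source := by
    rw [hes, OpenPartialHomeomorph.restr_source]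
    refine ⟨?_, mem_interior_iff_mem_nhds.2 hsrc⟩
    rw [OpenPartialHomeomorph.trans_source]
    refine ⟨hh0, ?_⟩
    rw [mem_preimage, hhf, hf0]
    exact chartOne_mem
  have hloc : ∀ᶠ v in 𝓝 (0 : E), modelExp G v = φ.symm (f v) := by
    filter_upwards [hsrc] with v hv
    exact (φ.left_inv hv).symm
  refine ⟨e, he, ⟨hzero, fun s t v => ?_, ?_⟩, ?_, ?_⟩
  · rw [he]
    exact modelExp_add_smul v s t
  -- In exponential coordinates the product is `h.symm ∘ chartMul ∘ (f × f)` near `0`, and `f` and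
  -- `h.symm` have identity derivative at the relevant points.
  · have h1 : HasStrictFDerivAt (fun p : E × E => (f p.1, f p.2))
        ((ContinuousLinearMap.fst ℝ E E).prod (ContinuousLinearMap.snd ℝ E E)) 0 := by
      have ha := HasStrictFDerivAt.comp (g := f) (f := Prod.fst) (0 : E × E) hf
        hasStrictFDerivAt_fst
      have hb := HasStrictFDerivAt.comp (g := f) (f := Prod.snd) (0 : E × E) hf
        hasStrictFDerivAt_snd
      exact ha.prodMk hb
    have h2 : HasStrictFDerivAt (Function.uncurry (chartMul E G))
        (ContinuousLinearMap.fst ℝ E E + ContinuousLinearMap.snd ℝ E E)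
        (f (0 : E × E).1, f (0 : E × E).2) := by
      simp only [Prod.fst_zero, Prod.snd_zero, hf0]
      exact hasStrictFDerivAt_chartMul
    have h3 := HasStrictFDerivAt.comp (f := fun p : E × E => (f p.1, f p.2)) (0 : E × E) h2 h1
    have h4 : HasStrictFDerivAt h.symm (ContinuousLinearMap.id ℝ E)
        ((Function.uncurry (chartMul E G) ∘ fun p : E × E => (f p.1, f p.2)) 0) := by
      have : (Function.uncurry (chartMul E G) ∘ fun p : E × E => (f p.1, f p.2)) 0 = f 0 := by
        simp only [Function.comp_apply, Function.uncurry_apply_pair, Prod.fst_zero, Prod.snd_zero,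
          hf0]
        exact chartMul_chartOne_left chartOne_mem
      rwa [this]
    have h5 := HasStrictFDerivAt.comp (0 : E × E) h4 h3
    refine h5.congr_of_eventuallyEq ?_
    have hev : ∀ᶠ p in 𝓝 (0 : E × E), modelExp G p.1 = φ.symm (f p.1) ∧
        modelExp G p.2 = φ.symm (f p.2) := by
      rw [show (0 : E × E) = (0, 0) from rfl, nhds_prod_eq]
      exact hloc.prod_mk hloc
    filter_upwards [hev] with p hp
    rw [he, hei', hp.1, hp.2]
    rfl
  · have h1 : HasMFDerivAt 𝓘(ℝ, E) 𝓘(ℝ, E) φ.symm (f 0) (ContinuousLinearMap.id ℝ E) := by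
      rw [hf0]
      exact hasMFDerivAt_chartAt_symm (1 : G)
    have h2 := HasMFDerivAt.comp (0 : E) h1 hf.hasFDerivAt.hasMFDerivAt
    rw [he]
    exact h2.congr_of_eventuallyEq hloc
  · have h1 : HasMFDerivAt 𝓘(ℝ, E) 𝓘(ℝ, E) h.symm (φ 1) (ContinuousLinearMap.id ℝ E) := by
      have : φ 1 = f 0 := hf0.symm
      rw [this]
      exact hsymm.hasFDerivAt.hasMFDerivAt
    have h2 := HasMFDerivAt.comp (1 : G) h1 (hasMFDerivAt_chartAt (1 : G))
    rw [hei]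
    exact h2

end LieExp

/-! ### Comparison of the two local constants -/

namespace LieExp

theorem le_of_forall_le_pow_mul {a b : ℝ≥0∞} (n : ℕ)
    (h : ∀ κ : ℝ≥0∞, 1 < κ → κ ≠ ⊤ → a ≤ κ ^ n * b) : a ≤ b := by
  rcases eq_or_ne b ⊤ with rfl | hb
  · exact le_top
  have h1 : Tendsto (fun κ : ℝ≥0∞ => κ ^ n * b) (𝓝[>] 1) (𝓝 (1 ^ n * b)) :=
    (ENNReal.Tendsto.mul_const ((ENNReal.continuous_pow n).tendsto 1) (.inr hb)).mono_left
      nhdsWithin_le_nhds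
  rw [one_pow, one_mul] at h1
  have : (𝓝[>] (1 : ℝ≥0∞)).NeBot := nhdsGT_neBot_of_exists_gt ⟨⊤, ENNReal.one_lt_top⟩
  refine ge_of_tendsto h1 ?_
  filter_upwards [Ioo_mem_nhdsGT ENNReal.one_lt_top] with κ hκ
  exact h κ hκ.1 hκ.2.ne

/-- This is how canonicity localises the integral: small supports in the factors confine the
integrand to a given neighbourhood of the base point. -/
theorem exists_nhds_of_isInducing {ι Y : Type*} {X : ι → Type*} [TopologicalSpace Y]
    [∀ j, TopologicalSpace (X j)] {σ : ∀ j, Y → X j} (hσ : IsInducing fun y j => σ j y) {y₀ : Y}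
    {s : Set Y} (hs : s ∈ 𝓝 y₀) :
    ∃ W : ∀ j, Set (X j), (∀ j, W j ∈ 𝓝 (σ j y₀)) ∧ ∀ y, (∀ j, σ j y ∈ W j) → y ∈ s := by
  rw [hσ.nhds_eq_comap, mem_comap] at hs
  obtain ⟨t, ht, hts⟩ := hs
  rw [nhds_pi, Filter.mem_pi] at ht
  obtain ⟨I, -, W, hW, hWt⟩ := ht
  exact ⟨W, hW, fun y hy => hts (hWt fun j _ => hy j)⟩

/-- If all `L j` kill `v`, then `σ` is trivial on `e (t • v)` for small `t > 0`, so `t • v = 0` by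
injectivity of `σ` and of `e` near `0`. -/
theorem injective_of_isExpChart {ι E G : Type*} [Fintype ι] [NormedAddCommGroup E]
    [NormedSpace ℝ E] [TopologicalSpace G] [Group G] {F H : ι → Type*}
    [∀ j, NormedAddCommGroup (F j)] [∀ j, NormedSpace ℝ (F j)] [∀ j, TopologicalSpace (H j)]
    [∀ j, Group (H j)] {e : OpenPartialHomeomorph E G} (he : IsExpChart e)
    {e' : ∀ j, OpenPartialHomeomorph (F j) (H j)} (he' : ∀ j, IsExpChart (e' j)) {σ : ∀ j, G →* H j}
    (hσ : Function.Injective fun (y : G) j => σ j y) {L : ∀ j, E →L[ℝ] F j}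
    (hL : ∀ j, ∀ᶠ v in 𝓝 0, σ j (e v) = e' j (L j v)) :
    Function.Injective (ContinuousLinearMap.pi L) := by
  rw [injective_iff_map_eq_zero]
  intro v hv
  have hLv : ∀ j, L j v = 0 := fun j => congrFun hv j
  have htend : Tendsto (fun t : ℝ => t • v) (𝓝[>] 0) (𝓝 0) := by
    have : Tendsto (fun t : ℝ => t • v) (𝓝 0) (𝓝 ((0 : ℝ) • v)) := tendsto_id.smul_const v
    rw [zero_smul] at this
    exact this.mono_left nhdsWithin_le_nhds
  obtain ⟨t, ⟨h1, h2⟩, ht⟩ := ((htend.eventually ((eventually_all.2 hL).and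
    (e.open_source.mem_nhds he.zero_mem))).and self_mem_nhdsWithin).exists
  have h3 : e (t • v) = e 0 := by
    refine hσ (funext fun j => ?_)
    simp only
    rw [h1 j, map_smul, hLv j, smul_zero, (he' j).map_zero, he.map_zero, map_one]
  have h4 := e.injOn h2 he.zero_mem h3
  exact (smul_eq_zero.1 h4).resolve_left (ne_of_gt ht)

section localConst

variable {ι E G : Type*} [Fintype ι] [NormedAddCommGroup E] [NormedSpace ℝ E]
  [FiniteDimensional ℝ E] [MeasurableSpace E] [BorelSpace E]
  [TopologicalSpace G] [Group G] [IsTopologicalGroup G] [T2Space G] [MeasurableSpace G]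
  [BorelSpace G] {F H : ι → Type*}
  [∀ j, NormedAddCommGroup (F j)] [∀ j, NormedSpace ℝ (F j)] [∀ j, FiniteDimensional ℝ (F j)]
  [∀ j, MeasurableSpace (F j)] [∀ j, BorelSpace (F j)]
  [∀ j, TopologicalSpace (H j)] [∀ j, Group (H j)] [∀ j, IsTopologicalGroup (H j)]
  [∀ j, T2Space (H j)] [∀ j, LocallyCompactSpace (H j)] [∀ j, MeasurableSpace (H j)]
  [∀ j, BorelSpace (H j)]

/-- The local Brascamp–Lieb constants of a canonical datum and of its linearisation in exponential
coordinates coincide. -/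
theorem localConst_eq_of_isExpChart {e : OpenPartialHomeomorph E G} (he : IsExpChart e)
    {e' : ∀ j, OpenPartialHomeomorph (F j) (H j)} (he' : ∀ j, IsExpChart (e' j))
    (μ : Measure G) [μ.IsHaarMeasure] (μ' : ∀ j, Measure (H j)) [∀ j, (μ' j).IsHaarMeasure]
    (ν : Measure E) [ν.IsAddHaarMeasure] (ν' : ∀ j, Measure (F j)) [∀ j, (ν' j).IsAddHaarMeasure]
    (hμν : Tendsto (fun r : ℝ => μ (e '' Metric.closedBall 0 r) / ν (Metric.closedBall 0 r))
      (𝓝[>] 0) (𝓝 1))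
    (hμν' : ∀ j, Tendsto (fun r : ℝ => μ' j (e' j '' Metric.closedBall 0 r) /
      ν' j (Metric.closedBall 0 r)) (𝓝[>] 0) (𝓝 1))
    (σ : ∀ j, G →* H j) {p : ι → ℝ≥0∞} (hp : ∀ j, 1 ≤ p j) (hσ : BrascampLieb.IsCanonical σ)
    {L : ∀ j, E →L[ℝ] F j} (hL : ∀ j, ∀ᶠ v in 𝓝 0, σ j (e v) = e' j (L j v)) :
    BrascampLieb.localConst μ μ' (fun j => σ j) p (fun _ => 1) =
      BrascampLieb.localConst ν ν' (fun j => L j) p (fun _ => 0) := by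
  have hσc : ∀ j, Continuous (σ j) := fun j => (continuous_apply j).comp hσ.continuous
  have hLc : ∀ j, Continuous (L j) := fun j => (L j).continuous
  have hLind : IsInducing fun (v : E) j => L j v :=
    (LinearMap.isClosedEmbedding_of_injective (f := (ContinuousLinearMap.pi L).toLinearMap)
      (LinearMap.ker_eq_bot.2 (injective_of_isExpChart he he' hσ.injective hL))).isInducing
  suffices key : ∀ κ : ℝ≥0∞, 1 < κ → κ ≠ ⊤ →
      BrascampLieb.localConst μ μ' (fun j => σ j) p (fun _ => 1) ≤ κ ^ (Fintype.card ι + 1) *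
        BrascampLieb.localConst ν ν' (fun j => L j) p (fun _ => 0) ∧
      BrascampLieb.localConst ν ν' (fun j => L j) p (fun _ => 0) ≤ κ ^ (Fintype.card ι + 1) *
        BrascampLieb.localConst μ μ' (fun j => σ j) p (fun _ => 1) from
    le_antisymm (le_of_forall_le_pow_mul _ fun κ h1 h2 => (key κ h1 h2).1)
      (le_of_forall_le_pow_mul _ fun κ h1 h2 => (key κ h1 h2).2)
  intro κ hκ hκ'
  obtain ⟨δ₀, hδ₀, hδs₀, hm₀⟩ := he.exists_measure_le μ ν hμν hκ hκ'
  choose δ hδ hδs hm using fun j => (he' j).exists_measure_le (μ' j) (ν' j) (hμν' j) hκ hκ'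
  have hLδ : ∀ᶠ v in 𝓝 (0 : E), ∀ j, L j v ∈ Metric.ball 0 (δ j) := by
    refine eventually_all.2 fun j => (hLc j).continuousAt.eventually ?_
    rw [map_zero]
    exact Metric.ball_mem_nhds _ (hδ j)
  -- On this ball the linearisation holds, every `L j` lands in the source of `θ j`, and the
  -- distortion of `μ` is controlled.
  obtain ⟨r, hr, hball⟩ := Metric.eventually_nhds_iff_ball.1
    (((eventually_all.2 hL).and hLδ).and (Metric.ball_mem_nhds (0 : E) hδ₀))
  let Θ : OpenPartialHomeomorph E G := e.restrOpen (Metric.ball 0 r) Metric.isOpen_ball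
  let θ : ∀ j, OpenPartialHomeomorph (F j) (H j) := fun j =>
    (e' j).restrOpen (Metric.ball 0 (δ j)) Metric.isOpen_ball
  have hΘs : Θ.source = Metric.ball 0 r := by
    rw [OpenPartialHomeomorph.restrOpen_source, inter_eq_right]
    exact fun v hv => hδs₀ (hball v hv).2
  have hθs : ∀ j, (θ j).source = Metric.ball 0 (δ j) := fun j => by
    rw [OpenPartialHomeomorph.restrOpen_source, inter_eq_right.2 (hδs j)]
  have h0Θ : (0 : E) ∈ Θ.source := hΘs ▸ Metric.mem_ball_self hr
  have h0θ : ∀ j, (0 : F j) ∈ (θ j).source := fun j => hθs j ▸ Metric.mem_ball_self (hδ j)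
  have hθ0 : ∀ j, θ j 0 = 1 := fun j => (he' j).map_zero
  have hint : ∀ v ∈ Θ.source, ∀ j, L j v ∈ (θ j).source ∧ σ j (Θ v) = θ j (L j v) := by
    intro v hv j
    rw [hΘs] at hv
    exact ⟨hθs j ▸ (hball v hv).1.2 j, (hball v hv).1.1 j⟩
  have hmΘ : ∀ s ⊆ Θ.source, MeasurableSet s → μ (Θ '' s) ≤ κ * ν s ∧ ν s ≤ κ * μ (Θ '' s) :=
    fun s hs => hm₀ s fun v hv => (hball v (hΘs ▸ hs hv)).2
  have hmθ : ∀ j, ∀ s ⊆ (θ j).source, MeasurableSet s →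
      μ' j (θ j '' s) ≤ κ * ν' j s ∧ ν' j s ≤ κ * μ' j (θ j '' s) :=
    fun j s hs => hm j s (hθs j ▸ hs)
  constructor
  · have h1Θ : Θ.target ∈ 𝓝 (1 : G) :=
      Θ.open_target.mem_nhds (he.map_zero ▸ Θ.map_source h0Θ)
    obtain ⟨W, hW, hWΘ⟩ := exists_nhds_of_isInducing hσ.isInducing h1Θ
    simp only [map_one] at hW
    refine BrascampLieb.localConst_le_mul (Θ := Θ) (θ := θ) hLc hσc hp hκ.le hκ' h0θ hθ0 hW hWΘ
      ?_ (BrascampLieb.measure_target_le fun s hs hsm => (hmΘ s hs hsm).1)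
      fun j s hs hsm => (hmθ j s hs hsm).2
    intro y hy j _
    obtain ⟨h1, h2⟩ := hint _ (Θ.map_target hy) j
    rw [Θ.right_inv hy] at h2
    rw [h2, (θ j).left_inv h1]
  -- The reverse inequality transports through the inverse homeomorphisms, localising by injectivity
  -- of the linear datum.
  · obtain ⟨W, hW, hWΘ⟩ := exists_nhds_of_isInducing hLind (Θ.open_source.mem_nhds h0Θ)
    simp only [map_zero] at hW
    refine BrascampLieb.localConst_le_mul (Θ := Θ.symm) (θ := fun j => (θ j).symm) hσc hLc hp hκ.le
      hκ' (fun j => hθ0 j ▸ (θ j).map_source (h0θ j))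
      (fun j => by rw [← hθ0 j, (θ j).left_inv (h0θ j)]) hW hWΘ
      (fun v hv j _ => (hint v hv j).2) (fun s hs hsm => (hmΘ s hs hsm).2)
      fun j => BrascampLieb.measure_target_le fun s hs hsm => (hmθ j s hs hsm).1

end localConst

/-- A continuous homomorphism of Lie groups is differentiable at the identity, and its differential
linearises it in exponential coordinates. -/
theorem eventually_map_modelExp {E G F H : Type*} [NormedAddCommGroup E] [NormedSpace ℝ E]
    [TopologicalSpace G] [ChartedSpace E G] [Group G] [ContinuousMul G]
    [NormedAddCommGroup F] [NormedSpace ℝ F]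
    [TopologicalSpace H] [ChartedSpace F H] [Group H]
    {e : OpenPartialHomeomorph E G} (he : IsExpChart e)
    (hde : HasMFDerivAt 𝓘(ℝ, E) 𝓘(ℝ, E) e.symm 1 (ContinuousLinearMap.id ℝ E))
    {e' : OpenPartialHomeomorph F H} (he' : IsExpChart e')
    (hde' : HasMFDerivAt 𝓘(ℝ, F) 𝓘(ℝ, F) e' 0 (ContinuousLinearMap.id ℝ F))
    (σ : G →* H) (hσ : Continuous σ) :
    ∀ᶠ v in 𝓝 (0 : E), σ (e v) = e' ((differential σ : E →L[ℝ] F) v) := by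
  obtain ⟨ℓ, hℓ⟩ := he.exists_continuousLinearMap he' σ hσ
  have h0 : ℓ (e.symm 1) = 0 := by rw [he.symm_one, map_zero]
  have h1 : HasMFDerivAt 𝓘(ℝ, F) 𝓘(ℝ, F) e' (ℓ (e.symm 1)) (ContinuousLinearMap.id ℝ F) := by
    rw [h0]
    exact hde'
  have h2 : HasMFDerivAt 𝓘(ℝ, E) 𝓘(ℝ, F) (fun g => ℓ (e.symm g)) (1 : G)
      (ℓ.comp (ContinuousLinearMap.id ℝ E)) :=
    HasMFDerivAt.comp (1 : G) (g := ℓ) ℓ.hasFDerivAt.hasMFDerivAt hde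
  have h3 := HasMFDerivAt.comp (1 : G) (f := fun g => ℓ (e.symm g)) h1 h2
  -- Differentiability of `σ` is deduced here: it is linear between coordinates whose derivatives
  -- are the identity, so its differential is `ℓ`.
  have h4 : ⇑σ =ᶠ[𝓝 (1 : G)] e' ∘ fun g => ℓ (e.symm g) := by
    have ht : Tendsto e.symm (𝓝 1) (𝓝 0) := by
      have := e.continuousAt_symm he.one_mem
      rwa [ContinuousAt, he.symm_one] at this
    filter_upwards [ht.eventually hℓ, e.open_target.mem_nhds he.one_mem] with g hg hg'
    rw [e.right_inv hg'] at hg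
    exact hg
  have h5 : HasMFDerivAt 𝓘(ℝ, E) 𝓘(ℝ, F) σ (1 : G) ℓ := h3.congr_of_eventuallyEq h4
  have h6 : (differential σ : E →L[ℝ] F) = ℓ := h5.mfderiv
  rw [h6]
  exact hℓ

end LieExp

theorem mainTheorem6 {ι : Type*} [Fintype ι]
    {E : Type*} [NormedAddCommGroup E] [NormedSpace ℝ E] [FiniteDimensional ℝ E]
    {G : Type*} [TopologicalSpace G] [ChartedSpace E G] [Group G] [LieGroup 𝓘(ℝ, E) ∞ G]
    [T2Space G] [MeasurableSpace G] [BorelSpace G]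
    {F : ι → Type*} [∀ j, NormedAddCommGroup (F j)] [∀ j, NormedSpace ℝ (F j)]
    [∀ j, FiniteDimensional ℝ (F j)]
    {H : ι → Type*} [∀ j, TopologicalSpace (H j)] [∀ j, ChartedSpace (F j) (H j)]
    [∀ j, Group (H j)] [∀ j, LieGroup 𝓘(ℝ, F j) ∞ (H j)] [∀ j, T2Space (H j)]
    [∀ j, MeasurableSpace (H j)] [∀ j, BorelSpace (H j)]
    (μ : Measure G) [μ.IsHaarMeasure] [μ.Regular]
    (μ' : ∀ j, Measure (H j)) [∀ j, (μ' j).IsHaarMeasure] [∀ j, (μ' j).Regular]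
    (ν : Measure (GroupLieAlgebra 𝓘(ℝ, E) G)) [ν.IsAddHaarMeasure]
    (ν' : ∀ j, Measure (GroupLieAlgebra 𝓘(ℝ, F j) (H j))) [∀ j, (ν' j).IsAddHaarMeasure]
    (hμν : LieExp.HasRNDerivAt μ ν 0 1) (hμν' : ∀ j, LieExp.HasRNDerivAt (μ' j) (ν' j) 0 1)
    (σ : ∀ j, G →* H j) (p : ι → ℝ≥0∞) (hp : ∀ j, 1 ≤ p j)
    (hσ : BrascampLieb.IsCanonical σ) :
    BrascampLieb.localConst μ μ' (fun j => σ j) p (fun _ => 1) =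
      BrascampLieb.localConst ν ν' (fun j => LieExp.differential (σ j)) p (fun _ => 0) := by
  have hG : IsTopologicalGroup G := topologicalGroup_of_lieGroup 𝓘(ℝ, E) ∞
  have hH : ∀ j, IsTopologicalGroup (H j) := fun j => topologicalGroup_of_lieGroup 𝓘(ℝ, F j) ∞
  have hHc : ∀ j, LocallyCompactSpace (H j) := fun j =>
    ChartedSpace.locallyCompactSpace (F j) (H j)
  obtain ⟨e, hee, he, -, hde⟩ := LieExp.exists_isExpChart (E := E) (G := G)
  choose e' hee' he' hde' _ using fun j => LieExp.exists_isExpChart (E := F j) (G := H j)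
  let : MeasurableSpace E := borel E
  have : BorelSpace E := ⟨rfl⟩
  let : ∀ j, MeasurableSpace (F j) := fun j => borel (F j)
  have : ∀ j, BorelSpace (F j) := fun j => ⟨rfl⟩
  have hσc : ∀ j, Continuous (σ j) := fun j => (continuous_apply j).comp hσ.continuous
  -- The Lie algebra is definitionally the model space with its Borel sets, so the measures can be
  -- viewed on `E` and `F j`.
  let N : Measure E := ν
  have : N.IsAddHaarMeasure := ‹ν.IsAddHaarMeasure›
  let N' : ∀ j, Measure (F j) := ν'
  have : ∀ j, (N' j).IsAddHaarMeasure := ‹∀ j, (ν' j).IsAddHaarMeasure›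
  refine LieExp.localConst_eq_of_isExpChart he he' μ μ' N N' ?_ (fun j => ?_) σ hp hσ
    (L := fun j => LieExp.differential (σ j))
    (fun j => LieExp.eventually_map_modelExp he hde (he' j) (hde' j) (σ j) (hσc j))
  · rw [hee]
    exact hμν
  · rw [hee' j]
    exact hμν' j
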